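/- Let $Q$ be a smooth finite-dimensional manifold, $g$ a smooth symmetric covariant two-tensor field on $Q$, $V\in C^\infty(Q)$, and $L(v_q)=\tfrac12 g_q(v_q,v_q)-V(q)$ a Lagrangian that is non-degenerate, i.e. its Legendre transformation $\mathbb{F}L:TQ\to T^*Q$ (the fibre derivative of $L$) is invertible. Let $H(p_q)=\langle p_q,(\mathbb{F}L)^{-1}(p_q)\rangle-L((\mathbb{F}L)^{-1}(p_q))$ be the Hamiltonian, $\Omega$ the canonical symplectic form on $T^*Q$, $\pi_Q:T^*Q\to Q$ the projection, and $X_H$ the Hamiltonian vector field, $i_{X_H}\Omega=dH$. Let $\Delta_Q\subset TQ$ be a regular (smooth subbundle) distribution with annihilator $\Delta_Q^\circ\subset T^*Q$, put $P=\mathbb{F}L(\Delta_Q)$ and $\Delta_{T^*Q}=(T\pi_Q)^{-1}(\Delta_Q)$, with annihilator $\Delta_{T^*Q}^\circ$. The nonholonomic Hamiltonian vector field $X_H^{\rm nh}$, defined at the points of $P$, is given by $$ i_{X_H^{\rm nh}}\Omega-dH\in\Delta_{T^*Q}^\circ,\qquad T\pi_Q(X_H^{\rm nh})\in\Delta_Q,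 $$ that is, by $\dot q=\partial H/\partial p$, $\dot p+\partial H/\partial q\in\Delta_Q^\circ$, $\dot q\in\Delta_Q$; by an integral curve of $X_H^{\rm nh}$ we mean a curve whose velocity satisfies these conditions at all times. Let $\gamma$ be a smooth one-form on $Q$ with $\gamma(q)\in P$ for all $q\in Q$ and $d\gamma(v,w)=0$ for all $v,w\in\Delta_Q(q)$, $q\in Q$. Then the following are equivalent: (i) for every curve $c:J\to Q$ on an open interval $J$ with $\dot c(t)=T\pi_Q\cdot X_H(\gamma(c(t)))$, the curve $t\mapsto\gamma(c(t))$ is an integral curve of $X_H^{\rm nh}$; (ii) $\gamma$ satisfies the nonholonomic Hamilton–Jacobi equation $d(H\circ\gamma)\in\Delta_Q^\circ$. If $g$ is moreover non-degenerate on every $\Delta_Q(q)$ (for instance if $g$ is Riemannian), the same equivalence holds when $X_H^{\rm nh}$ in (i) is the vector field along $P$ that is tangent to $P$ and satisfies the two conditions above, and integral curves are taken in the usual sense. Finally, if $Q$ is connected and $\Delta_Q$ is completely nonholonomic (the smooth local sections of $\Delta_Q$ together with their iterated Lie brackets span every tangent space), then (ii) is equivalent to $H\circ\gamma=E$ for some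 constant $E$. -/

import Mathlib

open Bundle Set
open scoped Manifold ContDiff Topology

noncomputable section

namespace NonholonomicHJ

section General

variable {E : Type*} [NormedAddCommGroup E] [NormedSpace ℝ E]
  {H : Type*} [TopologicalSpace H] (I : ModelWithCorners ℝ E H) [I.Boundaryless]
  {M : Type*} [TopologicalSpace M] [ChartedSpace H M]

/-- The local representative of a one-form `α` on `M` in the chart around `x`, i.e. the pullback of
`α` by the inverse of the chart. It is a one-form on the target of the chart, an open subset
of the model vector space `E`. -/
def formInChart (α : (y : M) → TangentSpace I y →L[ℝ] ℝ) (x : M) : E → E →L[ℝ] ℝ := fun y =>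
  (α ((extChartAt I x).symm y)).comp (mfderiv 𝓘(ℝ, E) I (extChartAt I x).symm y)

/-- The exterior derivative `dα(v, w)` of a one-form `α` at `x`, computed in the chart
around `x`: if `a = ∑ aᵢ dyⁱ` is the local representative, then
`da(v, w) = ∑ (∂ⱼ aᵢ - ∂ᵢ aⱼ) vʲ wⁱ = (D a · v) w - (D a · w) v`. -/
def exteriorDeriv (α : (y : M) → TangentSpace I y →L[ℝ] ℝ) (x : M) (v w : TangentSpace I x) : ℝ :=
  let v' : E := mfderiv I 𝓘(ℝ, E) (extChartAt I x) x v
  let w' : E := mfderiv I 𝓘(ℝ, E) (extChartAt I x) x w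
  fderiv ℝ (formInChart I α x) (extChartAt I x x) v' w'
    - fderiv ℝ (formInChart I α x) (extChartAt I x x) w' v'

end General

variable {E : Type*} [NormedAddCommGroup E] [NormedSpace ℝ E]
  {Q : Type*} [TopologicalSpace Q] [ChartedSpace E Q] [IsManifold 𝓘(ℝ, E) ∞ Q]

variable (E Q) in
/-- The cotangent bundle `T*Q`, as the bundle of continuous linear maps from `TQ` to the
trivial line bundle; Mathlib provides its manifold structure. -/
abbrev CotangentBundle : Type _ :=
  TotalSpace (E →L[ℝ] ℝ) (fun q : Q => TangentSpace 𝓘(ℝ, E) q →L[ℝ] Bundle.Trivial Q ℝ q)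

variable (E) in
/-- The model with corners of `T*Q`. -/
abbrev cotangentModel : ModelWithCorners ℝ (E × (E →L[ℝ] ℝ)) (ModelProd E (E →L[ℝ] ℝ)) :=
  𝓘(ℝ, E).prod 𝓘(ℝ, E →L[ℝ] ℝ)

/-- The tangent map `Tπ_Q : T T*Q → TQ` of the projection `π_Q : T*Q → Q`, at `z`. -/
def tangentProj (z : CotangentBundle E Q) :
    TangentSpace (cotangentModel E) z →L[ℝ] TangentSpace 𝓘(ℝ, E) z.proj :=
  mfderiv (cotangentModel E) 𝓘(ℝ, E) (fun y : CotangentBundle E Q => y.proj) z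

/-- The canonical (Liouville) one-form `Θ = p dq` on `T*Q`: `Θ_z(w) = ⟨z, Tπ_Q w⟩`. -/
def canonicalOneForm (z : CotangentBundle E Q) : TangentSpace (cotangentModel E) z →L[ℝ] ℝ :=
  ContinuousLinearMap.comp (show TangentSpace 𝓘(ℝ, E) z.proj →L[ℝ] ℝ from z.snd) (tangentProj z)

/-- The canonical symplectic form `Ω = -dΘ = dq ∧ dp` on `T*Q`. -/
def canonicalSymplecticForm (z : CotangentBundle E Q) (v w : TangentSpace (cotangentModel E) z) :
    ℝ :=
  -exteriorDeriv (cotangentModel E) canonicalOneForm z v w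

/-- `w` is the value at `z` of the Hamiltonian vector field of `Hm`: `i_w Ω = dHm(z)`. -/
def IsHamiltonianVector (Hm : CotangentBundle E Q → ℝ) (z : CotangentBundle E Q)
    (w : TangentSpace (cotangentModel E) z) : Prop :=
  ∀ u : TangentSpace (cotangentModel E) z,
    canonicalSymplecticForm z w u = mvfderiv (cotangentModel E) Hm z u

open Classical in
/-- The Hamiltonian vector field `X_H` on `T*Q`, the vector field with `i_{X_H} Ω = dH`. -/
def hamiltonianVectorField (Hm : CotangentBundle E Q → ℝ) (z : CotangentBundle E Q) :
    TangentSpace (cotangentModel E) z :=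
  if h : ∃ w, IsHamiltonianVector Hm z w then h.choose else 0

/-- The fibre derivative `⟨𝔽L(v), w⟩ = d/dt L(v + t w)` at `t = 0`, at a fixed base point `q`. -/
def fiberLegendre (L : TangentBundle 𝓘(ℝ, E) Q → ℝ) (q : Q) (v : TangentSpace 𝓘(ℝ, E) q) :
    TangentSpace 𝓘(ℝ, E) q →L[ℝ] ℝ :=
  fderiv ℝ (fun u : TangentSpace 𝓘(ℝ, E) q => L ⟨q, u⟩) v

/-- The Legendre transformation `𝔽L : TQ → T*Q`. -/
def legendre (L : TangentBundle 𝓘(ℝ, E) Q → ℝ) (v : TangentBundle 𝓘(ℝ, E) Q) :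
    CotangentBundle E Q :=
  ⟨v.proj, fiberLegendre L v.proj v.snd⟩

/-- `L` is non-degenerate: the Legendre transformation is invertible. -/
def IsNonDegenerate (L : TangentBundle 𝓘(ℝ, E) Q → ℝ) : Prop :=
  Function.Bijective (legendre L)

/-- The Hamiltonian `H(p) = ⟨p, (𝔽L)⁻¹(p)⟩ - L((𝔽L)⁻¹(p))` of a non-degenerate Lagrangian. -/
def hamiltonian (L : TangentBundle 𝓘(ℝ, E) Q → ℝ) (z : CotangentBundle E Q) : ℝ :=
  let p : TangentSpace 𝓘(ℝ, E) z.proj →L[ℝ] ℝ := z.snd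
  let v : TangentSpace 𝓘(ℝ, E) z.proj := Function.invFun (fiberLegendre L z.proj) p
  p v - L ⟨z.proj, v⟩

/-- The mechanical Lagrangian `L(v_q) = g_q(v_q, v_q) / 2 - V(q)`. -/
def mechanicalLagrangian
    (g : (q : Q) → TangentSpace 𝓘(ℝ, E) q →L[ℝ] TangentSpace 𝓘(ℝ, E) q →L[ℝ] ℝ) (V : Q → ℝ) :
    TangentBundle 𝓘(ℝ, E) Q → ℝ :=
  fun v => (1 / 2 : ℝ) * g v.proj v.snd v.snd - V v.proj

/-- `g` is a smooth symmetric covariant two-tensor field (a possibly indefinite and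
possibly degenerate metric). -/
structure IsSmoothMetric
    (g : (q : Q) → TangentSpace 𝓘(ℝ, E) q →L[ℝ] TangentSpace 𝓘(ℝ, E) q →L[ℝ] ℝ) : Prop where
  smooth : ContMDiff 𝓘(ℝ, E) (𝓘(ℝ, E).prod 𝓘(ℝ, E →L[ℝ] E →L[ℝ] ℝ)) ∞
    (fun q => TotalSpace.mk' (E →L[ℝ] E →L[ℝ] ℝ)
      (E := fun q : Q => TangentSpace 𝓘(ℝ, E) q →L[ℝ] TangentSpace 𝓘(ℝ, E) q →L[ℝ]
        Bundle.Trivial Q ℝ q) q (g q))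
  symm : ∀ q v w, g q v w = g q w v

/-- A one-form `γ`, seen as a map `γ : Q → T*Q`. -/
def toCotangent (γ : (q : Q) → TangentSpace 𝓘(ℝ, E) q →L[ℝ] ℝ) (q : Q) : CotangentBundle E Q :=
  ⟨q, γ q⟩

/-- The one-form `γ` is smooth. -/
def IsSmoothOneForm (γ : (q : Q) → TangentSpace 𝓘(ℝ, E) q →L[ℝ] ℝ) : Prop :=
  ContMDiff 𝓘(ℝ, E) (cotangentModel E) ∞ (toCotangent γ)

/-- The vector field `X` is smooth on `U`. -/
def IsSmoothVectorFieldOn (X : (q : Q) → TangentSpace 𝓘(ℝ, E) q) (U : Set Q) : Prop :=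
  ContMDiffOn 𝓘(ℝ, E) 𝓘(ℝ, E).tangent ∞ (fun q => (⟨q, X q⟩ : TangentBundle 𝓘(ℝ, E) Q)) U

/-- `Δ` is a regular distribution, i.e. a smooth subbundle of `TQ`: near every point
it has a smooth local frame. -/
def IsRegularDistribution (Δ : (q : Q) → Submodule ℝ (TangentSpace 𝓘(ℝ, E) q)) : Prop :=
  ∀ q₀ : Q, ∃ (U : Set Q) (k : ℕ) (X : Fin k → (q : Q) → TangentSpace 𝓘(ℝ, E) q),
    IsOpen U ∧ q₀ ∈ U ∧ (∀ i, IsSmoothVectorFieldOn (X i) U) ∧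
    ∀ q ∈ U, LinearIndependent ℝ (fun i => X i q) ∧
      Submodule.span ℝ (Set.range fun i => X i q) = Δ q

/-- The sections over `U` of the flag `Δ, [Δ, Δ], [Δ, [Δ, Δ]], …`: smooth sections of `Δ` over `U`
and their iterated Lie brackets. -/
inductive IsIteratedBracket (Δ : (q : Q) → Submodule ℝ (TangentSpace 𝓘(ℝ, E) q)) (U : Set Q) :
    ((q : Q) → TangentSpace 𝓘(ℝ, E) q) → Prop
  | base (X : (q : Q) → TangentSpace 𝓘(ℝ, E) q) (hX : IsSmoothVectorFieldOn X U)
      (hΔ : ∀ q ∈ U, X q ∈ Δ q) : IsIteratedBracket Δ U X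
  | bracket (X Y : (q : Q) → TangentSpace 𝓘(ℝ, E) q) (hX : IsSmoothVectorFieldOn X U)
      (hΔ : ∀ q ∈ U, X q ∈ Δ q) (hY : IsIteratedBracket Δ U Y) :
      IsIteratedBracket Δ U (VectorField.mlieBracket 𝓘(ℝ, E) X Y)

/-- `Δ` is completely nonholonomic (bracket-generating): `Δ` along with its iterated Lie brackets
spans the tangent bundle. -/
def IsCompletelyNonholonomic (Δ : (q : Q) → Submodule ℝ (TangentSpace 𝓘(ℝ, E) q)) : Prop :=
  ∀ q : Q, Submodule.span ℝ {v : TangentSpace 𝓘(ℝ, E) q | ∃ (U : Set Q)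
    (Y : (q : Q) → TangentSpace 𝓘(ℝ, E) q), IsOpen U ∧ q ∈ U ∧ IsIteratedBracket Δ U Y ∧
      Y q = v} = ⊤

/-- The annihilator `Δ° ⊆ T*Q`, fibrewise. -/
def annihilator (Δ : (q : Q) → Submodule ℝ (TangentSpace 𝓘(ℝ, E) q)) (q : Q) :
    Set (TangentSpace 𝓘(ℝ, E) q →L[ℝ] ℝ) :=
  {α | ∀ w ∈ Δ q, α w = 0}

/-- The constrained momentum space `P = 𝔽L(Δ) ⊆ T*Q`. -/
def momentumSpace (L : TangentBundle 𝓘(ℝ, E) Q → ℝ)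
    (Δ : (q : Q) → Submodule ℝ (TangentSpace 𝓘(ℝ, E) q)) : Set (CotangentBundle E Q) :=
  legendre L '' {v | v.snd ∈ Δ v.proj}

/-- The lifted distribution `Δ_{T*Q} = (Tπ_Q)⁻¹(Δ)` on `T*Q`. -/
def liftedDistribution (Δ : (q : Q) → Submodule ℝ (TangentSpace 𝓘(ℝ, E) q))
    (z : CotangentBundle E Q) : Submodule ℝ (TangentSpace (cotangentModel E) z) :=
  (Δ z.proj).comap (tangentProj z).toLinearMap

/-- The conditions defining the nonholonomic Hamiltonian vector field, for a vector `w`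
at `z`: `i_w Ω - dH ∈ Δ_{T*Q}°` and `Tπ_Q(w) ∈ Δ`. In coordinates,
`q' = ∂H/∂p`, `p' + ∂H/∂q ∈ Δ°`, `q' ∈ Δ`, for `w = (q', p')`. -/
def IsNonholonomicHamiltonVector (Hm : CotangentBundle E Q → ℝ)
    (Δ : (q : Q) → Submodule ℝ (TangentSpace 𝓘(ℝ, E) q)) (z : CotangentBundle E Q)
    (w : TangentSpace (cotangentModel E) z) : Prop :=
  (∀ u ∈ liftedDistribution Δ z,
    canonicalSymplecticForm z w u - mvfderiv (cotangentModel E) Hm z u = 0) ∧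
  tangentProj z w ∈ Δ z.proj

/-- The curve `ζ` in `T*Q` is, on the set `J` of times, a solution of the nonholonomic
Hamilton equations: its velocity exists and satisfies the conditions defining
the nonholonomic Hamiltonian vector field. -/
def SolvesNonholonomicHamilton (Hm : CotangentBundle E Q → ℝ)
    (Δ : (q : Q) → Submodule ℝ (TangentSpace 𝓘(ℝ, E) q)) (ζ : ℝ → CotangentBundle E Q)
    (J : Set ℝ) : Prop :=
  ∀ t ∈ J, ∃ w : TangentSpace (cotangentModel E) (ζ t),
    HasMFDerivAt 𝓘(ℝ, ℝ) (cotangentModel E) ζ t ((1 : ℝ →L[ℝ] ℝ).smulRight w) ∧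
    IsNonholonomicHamiltonVector Hm Δ (ζ t) w

/-- `X` is tangent to the subset `P` of `T*Q` at `z`: the vector `X z` is the velocity at time `0`
of a curve in `P` through `z`. -/
def IsTangentTo (X : (z : CotangentBundle E Q) → TangentSpace (cotangentModel E) z)
    (P : Set (CotangentBundle E Q)) (z : CotangentBundle E Q) : Prop :=
  ∃ ζ : ℝ → CotangentBundle E Q, ζ 0 = z ∧ (∀ᶠ t in 𝓝 (0 : ℝ), ζ t ∈ P) ∧
    HasMFDerivAt 𝓘(ℝ, ℝ) (cotangentModel E) ζ 0 ((1 : ℝ →L[ℝ] ℝ).smulRight (X (ζ 0)))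

/-- `X` is, at the points of `P`, a nonholonomic Hamiltonian vector field `X_H^nh`: it is
tangent to `P` and satisfies `i_X Ω - dH ∈ Δ_{T*Q}°` and `Tπ_Q(X) ∈ Δ`. The values of `X` outside of
`P` are irrelevant. -/
def IsNonholonomicHamiltonVectorField (Hm : CotangentBundle E Q → ℝ)
    (Δ : (q : Q) → Submodule ℝ (TangentSpace 𝓘(ℝ, E) q)) (P : Set (CotangentBundle E Q))
    (X : (z : CotangentBundle E Q) → TangentSpace (cotangentModel E) z) : Prop :=
  ∀ z ∈ P, IsTangentTo X P z ∧ IsNonholonomicHamiltonVector Hm Δ z (X z)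

/-- The vector field `q ↦ Tπ_Q · X_H(γ(q))` on `Q`. -/
def projectedHamiltonianVectorField (Hm : CotangentBundle E Q → ℝ)
    (γ : (q : Q) → TangentSpace 𝓘(ℝ, E) q →L[ℝ] ℝ) (q : Q) : TangentSpace 𝓘(ℝ, E) q :=
  tangentProj (toCotangent γ q) (hamiltonianVectorField Hm (toCotangent γ q))

/-- The nonholonomic Hamilton–Jacobi equation `d(H ∘ γ) ∈ Δ°`. -/
def NonholonomicHamiltonJacobi (Hm : CotangentBundle E Q → ℝ)
    (Δ : (q : Q) → Submodule ℝ (TangentSpace 𝓘(ℝ, E) q))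
    (γ : (q : Q) → TangentSpace 𝓘(ℝ, E) q →L[ℝ] ℝ) : Prop :=
  ∀ q : Q, mvfderiv 𝓘(ℝ, E) (Hm ∘ toCotangent γ) q ∈ annihilator Δ q

end NonholonomicHJ

end

noncomputable section

namespace NonholonomicHJ

variable {E : Type*} [NormedAddCommGroup E] [NormedSpace ℝ E]
  {Q : Type*} [TopologicalSpace Q] [ChartedSpace E Q] [IsManifold 𝓘(ℝ, E) ∞ Q]

/-! The equivalence with Hamilton–Jacobi is pointwise. In bundle coordinates `Ω((a, α), (b, β)) = β
a - α b`. Since the Legendre map is fibrewise `g`, the Hamiltonian is `H = ½ p(v) + V` with `v = g⁻¹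
p`, so `∂H/∂p = v`. Hence `Tπ_Q · X_H = v`, and `γ(q) ∈ P` says exactly that `v(γ(q)) ∈ Δ`.

The lift of an integral curve by `γ` has velocity `(v, A v)`, where `A` is the derivative of the
local representative of `γ`. Two of the three nonholonomic conditions then hold automatically; what
remains is `(A v) u + ∂H/∂q(u) = 0` for `u ∈ Δ`. By the chain rule `d(H ∘ γ)(u) = ∂H/∂q(u) + (A u)
v`. The two expressions differ by `dγ(v, u)`, which vanishes because `u` and `v` lie in `Δ`. This is
`isNonholonomicHamiltonVector_toCotangent_iff`. Local existence of integral curves through every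
point passes from points to curves.

For the vector field tangent to `P`, its value must moreover agree with the velocity of the lift. By
`IsNonholonomicHamiltonVector.unique`, two candidates differ by a vertical `α`. The equations give
`α ∈ Δ°`, tangency gives `g⁻¹ α ∈ Δ`, and non-degeneracy of `g` on `Δ` forces `α = 0`.

For the last claim, a function annihilated by `Δ` is annihilated by all iterated brackets of its
sections, by symmetry of second derivatives. Its differential is therefore zero, and it is constant
on a connected `Q`. -/

/-! ### Charts of the cotangent bundle. -/

theorem trivializationAt_cotangent_snd (x₀ : Q) (z : CotangentBundle E Q) :
    (trivializationAt (E →L[ℝ] ℝ) (fun q : Q => TangentSpace 𝓘(ℝ, E) q →L[ℝ] Bundle.Trivial Q ℝ q)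
      x₀ z).2 = ContinuousLinearMap.comp
        (show TangentSpace 𝓘(ℝ, E) z.proj →L[ℝ] ℝ from z.snd)
        ((trivializationAt E (TangentSpace 𝓘(ℝ, E)) x₀).symmL ℝ z.proj) := by
  rw [hom_trivializationAt_apply]
  simp [ContinuousLinearMap.inCoordinates]

theorem extChartAt_cotangent (z₀ z : CotangentBundle E Q) :
    extChartAt (cotangentModel E) z₀ z = (extChartAt 𝓘(ℝ, E) z₀.proj z.proj,
      ContinuousLinearMap.comp
        (show TangentSpace 𝓘(ℝ, E) z.proj →L[ℝ] ℝ from z.snd)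
        ((trivializationAt E (TangentSpace 𝓘(ℝ, E)) z₀.proj).symmL ℝ z.proj)) := by
  rw [FiberBundle.extChartAt]
  rw [← trivializationAt_cotangent_snd]
  simp
  rfl

theorem extChartAt_cotangent_target (z₀ : CotangentBundle E Q) :
    (extChartAt (cotangentModel E) z₀).target = (extChartAt 𝓘(ℝ, E) z₀.proj).target ×ˢ univ := by
  rw [FiberBundle.extChartAt_target]
  ext ⟨y, p⟩
  constructor
  · exact fun h => ⟨h.1.1, h.2⟩
  · refine fun h => ⟨⟨h.1, ?_⟩, h.2⟩
    have := (extChartAt 𝓘(ℝ, E) z₀.proj).map_target h.1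
    simp at this ⊢
    exact this

theorem extChartAt_cotangent_source (z₀ : CotangentBundle E Q) :
    (extChartAt (cotangentModel E) z₀).source =
      {z | z.proj ∈ (extChartAt 𝓘(ℝ, E) z₀.proj).source} := by
  rw [FiberBundle.extChartAt]
  ext z
  simp only [PartialEquiv.trans_source, mem_inter_iff, mem_preimage, PartialEquiv.prod_source,
    PartialEquiv.refl_source, mem_prod, mem_univ, and_true]
  refine ⟨fun h => h.2, fun h => ⟨?_, h⟩⟩
  simpa using! h

theorem extChartAt_cotangent_symm_proj (z₀ : CotangentBundle E Q) (y : E × (E →L[ℝ] ℝ))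
    (hy : y.1 ∈ (extChartAt 𝓘(ℝ, E) z₀.proj).target) :
    ((extChartAt (cotangentModel E) z₀).symm y).proj = (extChartAt 𝓘(ℝ, E) z₀.proj).symm y.1 := by
  rw [FiberBundle.extChartAt]
  have := (extChartAt 𝓘(ℝ, E) z₀.proj).map_target hy
  simp only [extChartAt_source] at this
  exact Trivialization.proj_symm_apply (trivializationAt (E →L[ℝ] ℝ)
    (fun q : Q => TangentSpace 𝓘(ℝ, E) q →L[ℝ] Bundle.Trivial Q ℝ q) z₀.proj)
    ((Trivialization.mem_target _).2 (by simpa using this))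

/-- Bundle charts are built from trivializations, while `formInChart` uses derivatives of charts;
this identifies the two. -/
theorem tangent_symmL (x₀ q : Q)  (hq : q ∈ (extChartAt 𝓘(ℝ, E) x₀).source) :
    (trivializationAt E (TangentSpace 𝓘(ℝ, E)) x₀).symmL ℝ q =
     mfderiv 𝓘(ℝ, E) 𝓘(ℝ, E) (extChartAt 𝓘(ℝ, E) x₀).symm (extChartAt 𝓘(ℝ, E) x₀ q) := by
  have : IsManifold 𝓘(ℝ, E) 1 Q := .of_le (n := ∞) (by norm_num)
  rw [TangentBundle.symmL_trivializationAt (by simpa using hq)]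
  simp
  rfl

theorem tangent_symmL_self (x : Q) :
    (trivializationAt E (TangentSpace 𝓘(ℝ, E)) x).symmL ℝ x = ContinuousLinearMap.id ℝ E := by
  have : IsManifold 𝓘(ℝ, E) 1 Q := .of_le (n := ∞) (by norm_num)
  rw [TangentBundle.symmL_trivializationAt (by simp)]
  exact mfderivWithin_range_extChartAt_symm

/-- Local coordinates read off `tangentProj` as the first projection. -/
theorem tangentProj_apply (z : CotangentBundle E Q) (w : TangentSpace (cotangentModel E) z) :
    tangentProj z w = (show E × (E →L[ℝ] ℝ) from w).1 := by
  have h : HasMFDerivAt (cotangentModel E) 𝓘(ℝ, E) (fun y : CotangentBundle E Q => y.proj) z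
      (ContinuousLinearMap.fst ℝ E (E →L[ℝ] ℝ)) := by
    refine ⟨(FiberBundle.continuous_proj _ _).continuousAt, ?_⟩
    refine HasFDerivAt.hasFDerivWithinAt (hasFDerivAt_fst.congr_of_eventuallyEq ?_)
    filter_upwards [extChartAt_target_mem_nhds (I := cotangentModel E) z] with y hy
    rw [extChartAt_cotangent_target] at hy
    simp only [writtenInExtChartAt, Function.comp]
    rw [extChartAt_cotangent_symm_proj _ _ hy.1]
    exact (extChartAt 𝓘(ℝ, E) z.proj).right_inv hy.1
  rw [tangentProj, h.mfderiv]
  rfl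

/-! ### The canonical one-form and symplectic form in coordinates. -/

theorem hasMFDerivAt_extChartAt_symm {F : Type*} [NormedAddCommGroup F] [NormedSpace ℝ F]
    {G : Type*} [TopologicalSpace G] (I : ModelWithCorners ℝ F G) [I.Boundaryless]
    {M : Type*} [TopologicalSpace M] [ChartedSpace G M] [IsManifold I 1 M] (x : M) (y : F)
    (hy : y ∈ (extChartAt I x).target) :
    HasMFDerivAt 𝓘(ℝ, F) I (extChartAt I x).symm y
      (mfderiv 𝓘(ℝ, F) I (extChartAt I x).symm y) := by
  have := mdifferentiableWithinAt_extChartAt_symm (I := I) hy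
  rw [I.range_eq_univ, mdifferentiableWithinAt_univ] at this
  exact this.hasMFDerivAt

theorem hasMFDerivAt_cotangent_proj (z : CotangentBundle E Q) :
    HasMFDerivAt (cotangentModel E) 𝓘(ℝ, E) (fun y : CotangentBundle E Q => y.proj) z
      (tangentProj z) :=
  ((contMDiff_proj (n := ∞) _).mdifferentiable (by simp) z).hasMFDerivAt

/-- The projection composed with a bundle chart inverse is the base chart inverse after `Prod.fst`;
the chain rule on both sides and uniqueness of derivatives give the formula. -/
theorem tangentProj_comp_mfderiv_extChartAt_symm (z₀ : CotangentBundle E Q)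
    (y : E × (E →L[ℝ] ℝ)) (hy : y ∈ (extChartAt (cotangentModel E) z₀).target)
    (w : E × (E →L[ℝ] ℝ)) :
    (tangentProj ((extChartAt (cotangentModel E) z₀).symm y)
      (mfderiv 𝓘(ℝ, E × (E →L[ℝ] ℝ)) (cotangentModel E)
        (extChartAt (cotangentModel E) z₀).symm y w) : E) =
    mfderiv 𝓘(ℝ, E) 𝓘(ℝ, E) (extChartAt 𝓘(ℝ, E) z₀.proj).symm y.1 w.1 := by
  have hQ : IsManifold 𝓘(ℝ, E) 1 Q := .of_le (n := ∞) (by norm_num)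
  have hT : IsManifold (cotangentModel E) 1 (CotangentBundle E Q) := .of_le (n := ∞) (by norm_num)
  have h1 := (hasMFDerivAt_cotangent_proj ((extChartAt (cotangentModel E) z₀).symm y)).comp y
    (hasMFDerivAt_extChartAt_symm (cotangentModel E) z₀ y hy)
  have hy1 : y.1 ∈ (extChartAt 𝓘(ℝ, E) z₀.proj).target := by
    rw [extChartAt_cotangent_target] at hy; exact hy.1
  have h2 := (hasMFDerivAt_extChartAt_symm 𝓘(ℝ, E) z₀.proj y.1 hy1).comp y
    ((hasFDerivAt_fst (𝕜 := ℝ) (E := E) (F := E →L[ℝ] ℝ) (p := y)).hasMFDerivAt)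
  have h3 : (fun y : CotangentBundle E Q => y.proj) ∘ (extChartAt (cotangentModel E) z₀).symm
      =ᶠ[𝓝 y] (extChartAt 𝓘(ℝ, E) z₀.proj).symm ∘ Prod.fst := by
    filter_upwards [(isOpen_extChartAt_target z₀).mem_nhds hy] with u hu
    rw [extChartAt_cotangent_target] at hu
    exact extChartAt_cotangent_symm_proj _ _ hu.1
  have h4 := hasMFDerivAt_unique h1 (h2.congr_of_eventuallyEq h3)
  exact congrArg (fun A => A w) h4

/-- This is `Θ = p dq`, valid on the whole chart target and so available for differentiation. -/
theorem formInChart_canonicalOneForm (z₀ : CotangentBundle E Q) (y : E × (E →L[ℝ] ℝ))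
    (hy : y ∈ (extChartAt (cotangentModel E) z₀).target) :
    formInChart (cotangentModel E) canonicalOneForm z₀ y =
      y.2.comp (ContinuousLinearMap.fst ℝ E (E →L[ℝ] ℝ)) := by
  have hy1 : y.1 ∈ (extChartAt 𝓘(ℝ, E) z₀.proj).target := by
    rw [extChartAt_cotangent_target] at hy; exact hy.1
  have hp := extChartAt_cotangent_symm_proj z₀ y hy1
  have hr := (extChartAt (cotangentModel E) z₀).right_inv hy
  rw [extChartAt_cotangent] at hr
  have hr2 := congrArg Prod.snd hr
  have hr1 := congrArg Prod.fst hr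
  dsimp only at hr1 hr2
  have hs : ((extChartAt (cotangentModel E) z₀).symm y).proj ∈
      (extChartAt 𝓘(ℝ, E) z₀.proj).source := by
    rw [hp]; exact (extChartAt 𝓘(ℝ, E) z₀.proj).map_target hy1
  rw [tangent_symmL _ _ hs, hr1] at hr2
  refine ContinuousLinearMap.ext fun w => ?_
  have h := tangentProj_comp_mfderiv_extChartAt_symm z₀ y hy w
  exact (congrArg (fun v : E => (show E →L[ℝ] ℝ from
    ((extChartAt (cotangentModel E) z₀).symm y).snd) v) h).trans
    (congrArg (fun A : E →L[ℝ] ℝ => A w.1) hr2)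

/-- The derivative of the chart at its own centre is the identity in Mathlib's model of the tangent
space. -/
theorem exteriorDeriv_apply {F : Type*} [NormedAddCommGroup F] [NormedSpace ℝ F]
    {G : Type*} [TopologicalSpace G] (I : ModelWithCorners ℝ F G) [I.Boundaryless]
    {M : Type*} [TopologicalSpace M] [ChartedSpace G M] [IsManifold I 1 M]
    (α : (y : M) → TangentSpace I y →L[ℝ] ℝ) (x : M) (v w : F) :
    exteriorDeriv I α x v w =
      fderiv ℝ (formInChart I α x) (extChartAt I x x) v w
        - fderiv ℝ (formInChart I α x) (extChartAt I x x) w v := by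
  have h (u : F) : (mfderiv I 𝓘(ℝ, F) (extChartAt I x) x u : F) = u := by
    rw [mfderiv_extChartAt_self]; rfl
  unfold exteriorDeriv
  exact congrArg₂ (fun v' w' : F => fderiv ℝ (formInChart I α x) (extChartAt I x x) v' w'
    - fderiv ℝ (formInChart I α x) (extChartAt I x x) w' v') (h v) (h w)

set_option synthInstance.maxHeartbeats 200000 in
theorem fderiv_comp_fst_apply (y v w : E × (E →L[ℝ] ℝ)) :
    fderiv ℝ (fun y : E × (E →L[ℝ] ℝ) => y.2.comp (ContinuousLinearMap.fst ℝ E (E →L[ℝ] ℝ))) y v w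
      = v.2 w.1 := by
  have h := HasFDerivAt.clm_comp (hasFDerivAt_snd (𝕜 := ℝ) (p := y))
    (hasFDerivAt_const (𝕜 := ℝ) (ContinuousLinearMap.fst ℝ E (E →L[ℝ] ℝ)) y)
  rw [h.fderiv]
  simp

theorem canonicalSymplecticForm_apply (z : CotangentBundle E Q) (v w : E × (E →L[ℝ] ℝ)) :
    canonicalSymplecticForm z v w = w.2 v.1 - v.2 w.1 := by
  have hT : IsManifold (cotangentModel E) 1 (CotangentBundle E Q) := .of_le (n := ∞) (by norm_num)
  have h : formInChart (cotangentModel E) canonicalOneForm z =ᶠ[𝓝 (extChartAt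
      (cotangentModel E) z z)] fun y => y.2.comp (ContinuousLinearMap.fst ℝ E (E →L[ℝ] ℝ)) := by
    filter_upwards [extChartAt_target_mem_nhds (I := cotangentModel E) z] with y hy
    exact formInChart_canonicalOneForm z y hy
  refine (congrArg Neg.neg (exteriorDeriv_apply (cotangentModel E) canonicalOneForm z v w)).trans ?_
  rw [h.fderiv_eq, fderiv_comp_fst_apply,
    fderiv_comp_fst_apply, neg_sub]

/-! ### One-forms as sections, and the fibres of the cotangent bundle. -/

theorem extChartAt_toCotangent (γ : (q : Q) → TangentSpace 𝓘(ℝ, E) q →L[ℝ] ℝ) (x : Q) (y : E)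
    (hy : y ∈ (extChartAt 𝓘(ℝ, E) x).target) :
    extChartAt (cotangentModel E) (toCotangent γ x)
        (toCotangent γ ((extChartAt 𝓘(ℝ, E) x).symm y)) =
      (y, formInChart 𝓘(ℝ, E) γ x y) := by
  have hq := (extChartAt 𝓘(ℝ, E) x).map_target hy
  have hr := (extChartAt 𝓘(ℝ, E) x).right_inv hy
  rw [extChartAt_cotangent]
  refine Prod.ext hr ?_
  dsimp only [toCotangent]
  rw [tangent_symmL _ _ hq, hr]
  rfl

theorem writtenInExtChartAt_toCotangent (γ : (q : Q) → TangentSpace 𝓘(ℝ, E) q →L[ℝ] ℝ) (x : Q) :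
    writtenInExtChartAt 𝓘(ℝ, E) (cotangentModel E) x (toCotangent γ) =ᶠ[𝓝 (extChartAt 𝓘(ℝ, E) x x)]
      fun y => (y, formInChart 𝓘(ℝ, E) γ x y) := by
  filter_upwards [extChartAt_target_mem_nhds (I := 𝓘(ℝ, E)) x] with y hy
  exact extChartAt_toCotangent γ x y hy

/-- In coordinates `γ` is the graph of its local representative. The vertical component is the same
derivative that `exteriorDeriv` antisymmetrizes, which is how `dγ` enters the argument. -/
theorem IsSmoothOneForm.hasMFDerivAt {γ : (q : Q) → TangentSpace 𝓘(ℝ, E) q →L[ℝ] ℝ}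
    (hγ : IsSmoothOneForm γ) (x : Q) :
    HasMFDerivAt 𝓘(ℝ, E) (cotangentModel E) (toCotangent γ) x
      ((ContinuousLinearMap.id ℝ E).prod
        (fderiv ℝ (formInChart 𝓘(ℝ, E) γ x) (extChartAt 𝓘(ℝ, E) x x))) := by
  have h := hγ.mdifferentiable (by simp) x
  have hd : DifferentiableAt ℝ (fun y => (y, formInChart 𝓘(ℝ, E) γ x y))
      (extChartAt 𝓘(ℝ, E) x x) := by
    have := h.differentiableWithinAt_writtenInExtChartAt
    rw [modelWithCornersSelf_coe, range_id, differentiableWithinAt_univ] at this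
    exact (writtenInExtChartAt_toCotangent γ x).differentiableAt_iff.1 this
  refine ⟨h.continuousAt, HasFDerivAt.hasFDerivWithinAt ?_⟩
  exact (HasFDerivAt.prodMk (hasFDerivAt_id _) hd.snd.hasFDerivAt).congr_of_eventuallyEq
    (writtenInExtChartAt_toCotangent γ x)

/-- The inclusion of a fibre of `T*Q`, as a map from the model fibre. -/
def fiberInclusion (q : Q) (p : E →L[ℝ] ℝ) : CotangentBundle E Q := ⟨q, p⟩

theorem extChartAt_fiberInclusion (q : Q) (p p' : E →L[ℝ] ℝ) :
    extChartAt (cotangentModel E) (fiberInclusion q p) (fiberInclusion q p') =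
      (extChartAt 𝓘(ℝ, E) q q, p') := by
  rw [extChartAt_cotangent]
  refine Prod.ext rfl ?_
  dsimp only [fiberInclusion]
  rw [tangent_symmL_self]
  rfl

theorem hasMFDerivAt_fiberInclusion (q : Q) (p : E →L[ℝ] ℝ) :
    HasMFDerivAt 𝓘(ℝ, E →L[ℝ] ℝ) (cotangentModel E) (fiberInclusion q) p
      (ContinuousLinearMap.inr ℝ E (E →L[ℝ] ℝ)) := by
  have h : ∀ p', extChartAt (cotangentModel E) (fiberInclusion q p) (fiberInclusion q p') =
      (extChartAt 𝓘(ℝ, E) q q, p') := extChartAt_fiberInclusion q p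
  have hs : ∀ p', fiberInclusion q p' ∈
      (extChartAt (cotangentModel E) (fiberInclusion q p)).source := by
    intro p'
    rw [extChartAt_cotangent_source]
    exact mem_extChartAt_source (I := 𝓘(ℝ, E)) q
  refine ⟨?_, HasFDerivAt.hasFDerivWithinAt ?_⟩
  · have : fiberInclusion q = (extChartAt (cotangentModel E) (fiberInclusion q p)).symm ∘
        fun p' => (extChartAt 𝓘(ℝ, E) q q, p') := by
      funext p'
      rw [Function.comp_apply, ← h p', PartialEquiv.left_inv _ (hs p')]
    rw [this]
    refine ContinuousAt.comp ?_ (by fun_prop)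
    rw [← h p]
    exact continuousAt_extChartAt_symm' (hs p)
  · refine ((hasFDerivAt_const (extChartAt 𝓘(ℝ, E) q q) _).prodMk (hasFDerivAt_id _)
      ).congr_of_eventuallyEq (Filter.Eventually.of_forall fun p' => ?_)
    exact h p'

/-- The fibre derivative of a function on `T*Q` determines its differential on vertical vectors. -/
theorem mvfderiv_vertical {F : Type*} [NormedAddCommGroup F] [NormedSpace ℝ F]
    {Hm : CotangentBundle E Q → F} {q : Q} {p : E →L[ℝ] ℝ}
    (hH : MDifferentiableAt (cotangentModel E) 𝓘(ℝ, F) Hm (fiberInclusion q p))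
    {D : (E →L[ℝ] ℝ) →L[ℝ] F}
    (hD : HasFDerivAt (fun p : E →L[ℝ] ℝ => Hm (fiberInclusion q p)) D p)
    (β : E →L[ℝ] ℝ) :
    mvfderiv (cotangentModel E) Hm (fiberInclusion q p) ((0 : E), β) = D β := by
  have h := (HasMFDerivAt.comp p hH.hasMFDerivAt (hasMFDerivAt_fiberInclusion q p))
  exact congrArg (fun A => A β) (hasMFDerivAt_unique h hD.hasMFDerivAt)

/-! ### Vectors, tensors and momenta in local components. -/

/-- The components of a tangent vector at `q` in the chart around `x₀`. -/
def tangentCoord (x₀ q : Q) : TangentSpace 𝓘(ℝ, E) q →L[ℝ] E :=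
  (trivializationAt E (TangentSpace 𝓘(ℝ, E)) x₀).continuousLinearMapAt ℝ q

/-- The tangent vector at `q` with given components in the chart around `x₀`. -/
def tangentCoordSymm (x₀ q : Q) : E →L[ℝ] TangentSpace 𝓘(ℝ, E) q :=
  (trivializationAt E (TangentSpace 𝓘(ℝ, E)) x₀).symmL ℝ q

theorem tangentCoord_symm {x₀ q : Q} (hq : q ∈ (extChartAt 𝓘(ℝ, E) x₀).source) (a : E) :
    tangentCoord x₀ q (tangentCoordSymm x₀ q a) = a :=
  Trivialization.continuousLinearMapAt_symmL _ (by simpa using hq) a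

theorem tangentCoordSymm_coord {x₀ q : Q} (hq : q ∈ (extChartAt 𝓘(ℝ, E) x₀).source)
    (v : TangentSpace 𝓘(ℝ, E) q) : tangentCoordSymm x₀ q (tangentCoord x₀ q v) = v :=
  Trivialization.symmL_continuousLinearMapAt _ (by simpa using hq) v

theorem tangentCoordSymm_self (x : Q) (a : E) : tangentCoordSymm x x a = a :=
  congrArg (fun A : E →L[ℝ] E => A a) (tangent_symmL_self x)

theorem tangentCoord_self (x : Q) (v : TangentSpace 𝓘(ℝ, E) x) : tangentCoord x x v = v := by
  have := tangentCoord_symm (mem_extChartAt_source (I := 𝓘(ℝ, E)) x) (v : E)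
  exact (congrArg (tangentCoord x x) (tangentCoordSymm_self (E := E) x v)).symm.trans this

theorem contMDiffAt_vectorField_iff (X : (q : Q) → TangentSpace 𝓘(ℝ, E) q) (x : Q) (n : ℕ∞) :
    ContMDiffAt 𝓘(ℝ, E) 𝓘(ℝ, E).tangent n (fun q => (⟨q, X q⟩ : TangentBundle 𝓘(ℝ, E) Q)) x ↔
      ContMDiffAt 𝓘(ℝ, E) 𝓘(ℝ, E) n (fun q => tangentCoord x q (X q)) x := by
  rw [contMDiffAt_totalSpace]
  have : (fun q => tangentCoord x q (X q)) =ᶠ[𝓝 x] fun q =>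
      (trivializationAt E (TangentSpace 𝓘(ℝ, E)) x (⟨q, X q⟩ : TangentBundle 𝓘(ℝ, E) Q)).2 := by
    filter_upwards [extChartAt_source_mem_nhds (I := 𝓘(ℝ, E)) x] with q hq
    exact congrFun (Trivialization.coe_linearMapAt_of_mem (R := ℝ)
      (trivializationAt E (TangentSpace 𝓘(ℝ, E)) x) (by simpa using hq)) _
  rw [this.contMDiffAt_iff]
  exact ⟨fun h => h.2, fun h => ⟨contMDiffAt_id, h⟩⟩

/-- The components of a two-tensor in the chart around `x₀`. -/
def tensorCoord (g : (q : Q) → TangentSpace 𝓘(ℝ, E) q →L[ℝ] TangentSpace 𝓘(ℝ, E) q →L[ℝ] ℝ)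
    (x₀ q : Q) : E →L[ℝ] E →L[ℝ] ℝ :=
  ContinuousLinearMap.bilinearComp (show E →L[ℝ] E →L[ℝ] ℝ from g q)
    (show E →L[ℝ] E from tangentCoordSymm x₀ q) (show E →L[ℝ] E from tangentCoordSymm x₀ q)

theorem tensorCoord_apply
    (g : (q : Q) → TangentSpace 𝓘(ℝ, E) q →L[ℝ] TangentSpace 𝓘(ℝ, E) q →L[ℝ] ℝ) (x₀ q : Q)
    (a b : E) :
    tensorCoord g x₀ q a b = g q (tangentCoordSymm x₀ q a) (tangentCoordSymm x₀ q b) := rfl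

theorem IsSmoothMetric.contMDiffAt_tensorCoord
    {g : (q : Q) → TangentSpace 𝓘(ℝ, E) q →L[ℝ] TangentSpace 𝓘(ℝ, E) q →L[ℝ] ℝ}
    (hg : IsSmoothMetric g) (x : Q) :
    ContMDiffAt 𝓘(ℝ, E) 𝓘(ℝ, E →L[ℝ] E →L[ℝ] ℝ) ∞ (tensorCoord g x) x := by
  have h := (contMDiffAt_hom_bundle _).1 (hg.smooth x)
  refine h.2.congr_of_eventuallyEq ?_
  filter_upwards [extChartAt_source_mem_nhds (I := 𝓘(ℝ, E)) x] with q hq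
  ext a b
  have h1 := congrFun (Trivialization.coe_linearMapAt_of_mem (R := ℝ) (trivializationAt (E →L[ℝ] ℝ)
    (fun q : Q => TangentSpace 𝓘(ℝ, E) q →L[ℝ] Bundle.Trivial Q ℝ q) x) (b := q)
    (by simpa using hq)) (g q (tangentCoordSymm x q a))
  have h2 := trivializationAt_cotangent_snd x ⟨q, g q (tangentCoordSymm x q a)⟩
  exact (congrArg (fun A : E →L[ℝ] ℝ => A b) (h1.trans h2)).symm

theorem contMDiffAt_cotangentCoord (z₀ : CotangentBundle E Q) :
    ContMDiffAt (cotangentModel E) 𝓘(ℝ, E →L[ℝ] ℝ) ∞ (fun z : CotangentBundle E Q =>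
      ContinuousLinearMap.comp
        (show TangentSpace 𝓘(ℝ, E) z.proj →L[ℝ] ℝ from z.snd)
        (tangentCoordSymm z₀.proj z.proj)) z₀ := by
  refine ((contMDiffAt_totalSpace.1 (contMDiffAt_id (x := z₀))).2).congr_of_eventuallyEq ?_
  filter_upwards with z
  exact (trivializationAt_cotangent_snd _ _).symm

/-! ### The Legendre transformation and the mechanical Hamiltonian. -/

theorem hasFDerivAt_quadratic {F : Type*} [NormedAddCommGroup F] [NormedSpace ℝ F]
    (B : F →L[ℝ] F →L[ℝ] ℝ) (hB : ∀ v w, B v w = B w v) (c : ℝ) (v : F) :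
    HasFDerivAt (fun u => (1 / 2 : ℝ) * B u u - c) (B v) v := by
  have h := ((B.hasFDerivAt.clm_apply (hasFDerivAt_id v)).const_mul (1 / 2 : ℝ)).sub_const c
  refine h.congr_fderiv (ContinuousLinearMap.ext fun w => ?_)
  simp [hB w v]
  ring

theorem IsSmoothMetric.fiberLegendre_mechanicalLagrangian
    {g : (q : Q) → TangentSpace 𝓘(ℝ, E) q →L[ℝ] TangentSpace 𝓘(ℝ, E) q →L[ℝ] ℝ}
    (hg : IsSmoothMetric g) (V : Q → ℝ) (q : Q) :
    fiberLegendre (mechanicalLagrangian g V) q = g q :=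
  funext fun v => HasFDerivAt.fderiv (hasFDerivAt_quadratic (F := E) (g q) (hg.symm q) (V q) v)

omit [IsManifold 𝓘(ℝ, E) ∞ Q] in
theorem IsNonDegenerate.bijective {L : TangentBundle 𝓘(ℝ, E) Q → ℝ} (hL : IsNonDegenerate L)
    (q : Q) : Function.Bijective (fiberLegendre L q) := by
  constructor
  · intro v w h
    have : (⟨q, v⟩ : TangentBundle 𝓘(ℝ, E) Q) = ⟨q, w⟩ := hL.1 (by simp [legendre, h])
    simpa using this
  · intro p
    obtain ⟨⟨q', v⟩, hv⟩ := hL.2 ⟨q, p⟩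
    obtain rfl : q' = q := congrArg TotalSpace.proj hv
    exact ⟨v, by simpa [legendre] using hv⟩

/-- The velocity `v` with `g(v, ·) = p`, for a momentum `p`. -/
def velocity (g : (q : Q) → TangentSpace 𝓘(ℝ, E) q →L[ℝ] TangentSpace 𝓘(ℝ, E) q →L[ℝ] ℝ)
    (z : CotangentBundle E Q) : TangentSpace 𝓘(ℝ, E) z.proj :=
  Function.invFun (g z.proj) z.snd

section

variable {g : (q : Q) → TangentSpace 𝓘(ℝ, E) q →L[ℝ] TangentSpace 𝓘(ℝ, E) q →L[ℝ] ℝ}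

omit [IsManifold 𝓘(ℝ, E) ∞ Q] in
theorem metric_velocity (hb : ∀ q, Function.Bijective (g q)) (z : CotangentBundle E Q) :
    g z.proj (velocity g z) = z.snd :=
  Function.invFun_eq ((hb z.proj).2 z.snd)

omit [IsManifold 𝓘(ℝ, E) ∞ Q] in
theorem velocity_eq_iff (hb : ∀ q, Function.Bijective (g q)) (z : CotangentBundle E Q)
    (v : TangentSpace 𝓘(ℝ, E) z.proj) : velocity g z = v ↔ z.snd = g z.proj v :=
  ⟨fun h => h ▸ (metric_velocity hb z).symm,
    fun h => (hb z.proj).1 ((metric_velocity hb z).trans h)⟩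

theorem tensorCoord_bijective (hb : ∀ q, Function.Bijective (g q)) {x₀ q : Q}
    (hq : q ∈ (extChartAt 𝓘(ℝ, E) x₀).source) : Function.Bijective (tensorCoord g x₀ q) := by
  constructor
  · rw [injective_iff_map_eq_zero]
    intro a ha
    have h1 : g q (tangentCoordSymm x₀ q a) = 0 := by
      refine ContinuousLinearMap.ext fun v => ?_
      have := congrArg (fun A : E →L[ℝ] ℝ => A (tangentCoord x₀ q v)) ha
      rw [tensorCoord_apply, tangentCoordSymm_coord hq] at this
      exact this
    have h2 := (injective_iff_map_eq_zero _).1 (hb q).1 _ h1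
    rw [← tangentCoord_symm hq a, h2, map_zero]
  · intro p
    obtain ⟨v, hv⟩ := (hb q).2 (p.comp (tangentCoord x₀ q))
    refine ⟨tangentCoord x₀ q v, ContinuousLinearMap.ext fun b => ?_⟩
    rw [tensorCoord_apply, tangentCoordSymm_coord hq, hv, ContinuousLinearMap.comp_apply,
      tangentCoord_symm hq]

theorem tensorCoord_isInvertible [FiniteDimensional ℝ E] (hb : ∀ q, Function.Bijective (g q))
    {x₀ q : Q} (hq : q ∈ (extChartAt 𝓘(ℝ, E) x₀).source) : (tensorCoord g x₀ q).IsInvertible :=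
  ⟨(LinearEquiv.ofBijective (tensorCoord g x₀ q).toLinearMap
    (tensorCoord_bijective hb hq)).toContinuousLinearEquiv, rfl⟩

/-- Expresses `g⁻¹ p` through operator inversion in a fixed space, which is smooth at invertible
operators. -/
theorem tangentCoord_velocity [FiniteDimensional ℝ E] (hb : ∀ q, Function.Bijective (g q))
    {x₀ : Q} {z : CotangentBundle E Q} (hz : z.proj ∈ (extChartAt 𝓘(ℝ, E) x₀).source) :
    tangentCoord x₀ z.proj (velocity g z) = (tensorCoord g x₀ z.proj).inverse
      (ContinuousLinearMap.comp (show TangentSpace 𝓘(ℝ, E) z.proj →L[ℝ] ℝ from z.snd)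
        (tangentCoordSymm x₀ z.proj)) := by
  rw [eq_comm, (tensorCoord_isInvertible hb hz).inverse_apply_eq]
  refine ContinuousLinearMap.ext fun b => ?_
  rw [tensorCoord_apply, tangentCoordSymm_coord hz, metric_velocity hb]
  rfl

theorem IsSmoothMetric.contMDiffAt_velocity [FiniteDimensional ℝ E] (hg : IsSmoothMetric g)
    (hb : ∀ q, Function.Bijective (g q)) (z₀ : CotangentBundle E Q) :
    ContMDiffAt (cotangentModel E) 𝓘(ℝ, E) ∞
      (fun z : CotangentBundle E Q => tangentCoord z₀.proj z.proj (velocity g z)) z₀ := by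
  have : CompleteSpace E := FiniteDimensional.complete ℝ E
  have hi := tensorCoord_isInvertible hb (mem_extChartAt_source (I := 𝓘(ℝ, E)) z₀.proj)
  have hproj : ContMDiffAt (cotangentModel E) 𝓘(ℝ, E) ∞
      (fun z : CotangentBundle E Q => z.proj) z₀ := contMDiff_proj _ z₀
  have h1 : ContMDiffAt (cotangentModel E) 𝓘(ℝ, E →L[ℝ] E →L[ℝ] ℝ) ∞
      (fun z : CotangentBundle E Q => tensorCoord g z₀.proj z.proj) z₀ :=
    (hg.contMDiffAt_tensorCoord z₀.proj).comp z₀ hproj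
  have h2 : ContMDiffAt (cotangentModel E) 𝓘(ℝ, (E →L[ℝ] ℝ) →L[ℝ] E) ∞
      (fun z : CotangentBundle E Q => (tensorCoord g z₀.proj z.proj).inverse) z₀ :=
    (hi.contDiffAt_map_inverse (n := ∞)).contMDiffAt.comp z₀ h1
  refine (h2.clm_apply (contMDiffAt_cotangentCoord z₀)).congr_of_eventuallyEq ?_
  filter_upwards [hproj.continuousAt.preimage_mem_nhds
    (extChartAt_source_mem_nhds (I := 𝓘(ℝ, E)) z₀.proj)] with z hz
  exact tangentCoord_velocity hb hz

theorem IsSmoothMetric.hamiltonian_eq (hg : IsSmoothMetric g)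
    (hb : ∀ q, Function.Bijective (g q)) (V : Q → ℝ) (z : CotangentBundle E Q) :
    hamiltonian (mechanicalLagrangian g V) z =
      (1 / 2 : ℝ) * (show TangentSpace 𝓘(ℝ, E) z.proj →L[ℝ] ℝ from z.snd) (velocity g z)
        + V z.proj := by
  unfold hamiltonian
  rw [hg.fiberLegendre_mechanicalLagrangian]
  change z.snd (velocity g z) - ((1 / 2 : ℝ) * g z.proj (velocity g z) (velocity g z) - V z.proj)
    = _
  rw [metric_velocity hb]
  ring

theorem IsSmoothMetric.contMDiff_hamiltonian [FiniteDimensional ℝ E] (hg : IsSmoothMetric g)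
    (hb : ∀ q, Function.Bijective (g q)) {V : Q → ℝ} (hV : ContMDiff 𝓘(ℝ, E) 𝓘(ℝ, ℝ) ∞ V) :
    ContMDiff (cotangentModel E) 𝓘(ℝ, ℝ) ∞ (hamiltonian (mechanicalLagrangian g V)) := by
  intro z₀
  have hproj : ContMDiffAt (cotangentModel E) 𝓘(ℝ, E) ∞
      (fun z : CotangentBundle E Q => z.proj) z₀ := contMDiff_proj _ z₀
  have h1 := (contMDiffAt_cotangentCoord z₀).clm_apply (hg.contMDiffAt_velocity hb z₀)
  have h2 := ((contMDiffAt_const (c := (1 / 2 : ℝ))).mul h1).add ((hV z₀.proj).comp z₀ hproj)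
  refine h2.congr_of_eventuallyEq ?_
  filter_upwards [hproj.continuousAt.preimage_mem_nhds
    (extChartAt_source_mem_nhds (I := 𝓘(ℝ, E)) z₀.proj)] with z hz
  rw [hg.hamiltonian_eq hb]
  simp [tangentCoordSymm_coord hz]

/-- The isomorphism of the model fibres given by the metric at `q`. -/
def metricEquiv [FiniteDimensional ℝ E] (hb : ∀ q, Function.Bijective (g q)) (q : Q) :
    E ≃L[ℝ] (E →L[ℝ] ℝ) :=
  (LinearEquiv.ofBijective (show E →L[ℝ] E →L[ℝ] ℝ from g q).toLinearMap
    (hb q)).toContinuousLinearEquiv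

omit [IsManifold 𝓘(ℝ, E) ∞ Q] in
theorem velocity_fiberInclusion [FiniteDimensional ℝ E] (hb : ∀ q, Function.Bijective (g q))
    (q : Q) (p : E →L[ℝ] ℝ) : velocity g (fiberInclusion q p) = (metricEquiv hb q).symm p :=
  (velocity_eq_iff hb _ _).2 ((metricEquiv hb q).apply_symm_apply p).symm

/-- This is `∂H/∂p = g⁻¹ p`: on a fibre `H` is, up to a constant, half the quadratic form of `g⁻¹`,
and `g⁻¹` is symmetric. -/
theorem IsSmoothMetric.mvfderiv_hamiltonian_vertical [FiniteDimensional ℝ E]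
    (hg : IsSmoothMetric g)
    (hb : ∀ q, Function.Bijective (g q)) {V : Q → ℝ} (hV : ContMDiff 𝓘(ℝ, E) 𝓘(ℝ, ℝ) ∞ V)
    (z : CotangentBundle E Q) (β : E →L[ℝ] ℝ) :
    mvfderiv (cotangentModel E) (hamiltonian (mechanicalLagrangian g V)) z ((0 : E), β) =
      β (velocity g z) := by
  obtain ⟨q, p⟩ := z
  let e : E ≃L[ℝ] (E →L[ℝ] ℝ) := metricEquiv hb q
  have he : ∀ p : E →L[ℝ] ℝ, velocity g (fiberInclusion q p) = e.symm p :=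
    velocity_fiberInclusion hb q
  -- The inverse metric, `B p p' = p' (g⁻¹ p)`.
  let B : (E →L[ℝ] ℝ) →L[ℝ] (E →L[ℝ] ℝ) →L[ℝ] ℝ :=
    (ContinuousLinearMap.apply ℝ ℝ).comp (e.symm : (E →L[ℝ] ℝ) →L[ℝ] E)
  have hB : ∀ p p', B p p' = B p' p := by
    intro p p'
    have h1 : B p p' = e (e.symm p') (e.symm p) := by simp [B]
    have h2 : B p' p = e (e.symm p) (e.symm p') := by simp [B]
    rw [h1, h2]
    exact hg.symm q _ _
  have hD := hasFDerivAt_quadratic B hB (-V q) p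
  have heq : (fun u => (1 / 2 : ℝ) * B u u - -V q) =
      fun p : E →L[ℝ] ℝ => hamiltonian (mechanicalLagrangian g V) (fiberInclusion q p) := by
    funext p
    rw [hg.hamiltonian_eq hb, he, sub_neg_eq_add]
    rfl
  rw [heq] at hD
  refine (mvfderiv_vertical (q := q)
    ((hg.contMDiff_hamiltonian hb hV).mdifferentiable (by simp) _) hD β).trans ?_
  exact congrArg β (he p).symm

end

/-! ### Hamilton's equations, free and nonholonomic. -/

section

variable {Hm : CotangentBundle E Q → ℝ}
  {vel : (z : CotangentBundle E Q) → TangentSpace 𝓘(ℝ, E) z.proj}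

theorem mvfderiv_cotangent_apply
    (hv : ∀ z (β : E →L[ℝ] ℝ), mvfderiv (cotangentModel E) Hm z ((0 : E), β) = β (vel z))
    (z : CotangentBundle E Q) (a : E) (β : E →L[ℝ] ℝ) :
    mvfderiv (cotangentModel E) Hm z (a, β) =
      mvfderiv (cotangentModel E) Hm z (a, (0 : E →L[ℝ] ℝ)) + β (vel z) := by
  rw [← hv z β]
  have h : (a, β) = (a, (0 : E →L[ℝ] ℝ)) + ((0 : E), β) := by simp
  exact (congrArg (mvfderiv (cotangentModel E) Hm z) h).trans
    (map_add (mvfderiv (cotangentModel E) Hm z) _ _)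

/-- Ensures that the default value `0` in `hamiltonianVectorField` is never taken. -/
theorem isHamiltonianVector_hamiltonianVectorField
    (hv : ∀ z (β : E →L[ℝ] ℝ), mvfderiv (cotangentModel E) Hm z ((0 : E), β) = β (vel z))
    (z : CotangentBundle E Q) : IsHamiltonianVector Hm z (hamiltonianVectorField Hm z) := by
  have h : ∃ w, IsHamiltonianVector Hm z w := by
    let D : E × (E →L[ℝ] ℝ) →L[ℝ] ℝ := mvfderiv (cotangentModel E) Hm z
    -- Hamilton's equations give the witness `(∂H/∂p, -∂H/∂q)`.
    refine ⟨(vel z, -D.comp (ContinuousLinearMap.inl ℝ E (E →L[ℝ] ℝ))), fun u => ?_⟩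
    obtain ⟨a, β⟩ := u
    refine (canonicalSymplecticForm_apply z _ _).trans ?_
    rw [mvfderiv_cotangent_apply hv]
    change β (vel z) - -(D (a, 0)) = D (a, 0) + _
    ring
  unfold hamiltonianVectorField
  rw [dif_pos h]
  exact h.choose_spec

theorem eq_of_forall_dual_apply_eq {v w : E} (h : ∀ β : E →L[ℝ] ℝ, β v = β w) : v = w :=
  (SeparatingDual.eq_iff_forall_dual_eq (R := ℝ)).2 h

theorem tangentProj_hamiltonianVectorField
    (hv : ∀ z (β : E →L[ℝ] ℝ), mvfderiv (cotangentModel E) Hm z ((0 : E), β) = β (vel z))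
    (z : CotangentBundle E Q) : tangentProj z (hamiltonianVectorField Hm z) = vel z := by
  rw [tangentProj_apply]
  refine eq_of_forall_dual_apply_eq (E := E) fun β => ?_
  have h := isHamiltonianVector_hamiltonianVectorField hv z ((0 : E), β)
  refine Eq.trans ?_ (h.trans (hv z β))
  refine Eq.symm ((canonicalSymplecticForm_apply z _ _).trans ?_)
  simp

theorem isNonholonomicHamiltonVector_iff
    (hv : ∀ z (β : E →L[ℝ] ℝ), mvfderiv (cotangentModel E) Hm z ((0 : E), β) = β (vel z))
    (Δ : (q : Q) → Submodule ℝ (TangentSpace 𝓘(ℝ, E) q)) (z : CotangentBundle E Q)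
    (a : E) (α : E →L[ℝ] ℝ) :
    IsNonholonomicHamiltonVector Hm Δ z (a, α) ↔ a = vel z ∧ (vel z ∈ Δ z.proj) ∧
      ∀ u ∈ Δ z.proj, α u + mvfderiv (cotangentModel E) Hm z ((u : E), (0 : E →L[ℝ] ℝ)) = 0 := by
  have hm (u : E) (β : E →L[ℝ] ℝ) :
      ((u, β) : TangentSpace (cotangentModel E) z) ∈ liftedDistribution Δ z ↔ u ∈ Δ z.proj := by
    exact Iff.of_eq (congrArg (· ∈ Δ z.proj) (tangentProj_apply z (u, β)))
  have hΩ (u : E) (β : E →L[ℝ] ℝ) :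
      canonicalSymplecticForm z (a, α) (u, β) - mvfderiv (cotangentModel E) Hm z (u, β) =
        (β a - β (vel z)) -
          (α u + mvfderiv (cotangentModel E) Hm z (u, (0 : E →L[ℝ] ℝ))) := by
    rw [mvfderiv_cotangent_apply hv]
    refine (congrArg (· - _) (canonicalSymplecticForm_apply z _ _)).trans ?_
    dsimp only
    ring
  have hp : tangentProj z (a, α) = a := tangentProj_apply z (a, α)
  unfold IsNonholonomicHamiltonVector
  rw [hp]
  constructor
  · rintro ⟨h1, h2⟩
    -- Vertical vectors all lie in the lifted distribution, so testing on them recovers `q' = ∂H/∂p`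
    -- in full; testing on `(u, 0)` with `u ∈ Δ` then leaves the momentum equation.
    have ha : a = vel z := by
      refine eq_of_forall_dual_apply_eq fun β => ?_
      have h3 := (hΩ 0 β).symm.trans (h1 (0, β) ((hm 0 β).2 (Submodule.zero_mem _)))
      have h4 : mvfderiv (cotangentModel E) Hm z ((0 : E), (0 : E →L[ℝ] ℝ)) = 0 :=
        (mvfderiv (cotangentModel E) Hm z).map_zero
      rw [h4, map_zero] at h3
      linarith
    refine ⟨ha, ha ▸ h2, fun u hu => ?_⟩
    have h3 := (hΩ u 0).symm.trans (h1 (u, 0) ((hm u 0).2 hu))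
    have h4 : (0 : E →L[ℝ] ℝ) a - (0 : E →L[ℝ] ℝ) (vel z) = 0 := sub_self 0
    rw [h4] at h3
    linarith
  · rintro ⟨rfl, h2, h3⟩
    refine ⟨?_, h2⟩
    rintro ⟨u, β⟩ hu
    refine (hΩ u β).trans ?_
    rw [h3 u ((hm u β).1 hu), sub_self, sub_zero]

/-- Heart of the proof: the left-hand sides of the momentum equation and of the Hamilton–Jacobi
equation, evaluated on `u ∈ Δ`, differ by `dγ(v, u) = 0`. -/
theorem isNonholonomicHamiltonVector_toCotangent_iff
    (hH : MDifferentiable (cotangentModel E) 𝓘(ℝ, ℝ) Hm)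
    (hv : ∀ z (β : E →L[ℝ] ℝ), mvfderiv (cotangentModel E) Hm z ((0 : E), β) = β (vel z))
    {Δ : (q : Q) → Submodule ℝ (TangentSpace 𝓘(ℝ, E) q)}
    {γ : (q : Q) → TangentSpace 𝓘(ℝ, E) q →L[ℝ] ℝ} (hγ : IsSmoothOneForm γ) {q : Q}
    (hvΔ : vel (toCotangent γ q) ∈ Δ q)
    (hdγ : ∀ v ∈ Δ q, ∀ w ∈ Δ q, exteriorDeriv 𝓘(ℝ, E) γ q v w = 0) :
    IsNonholonomicHamiltonVector Hm Δ (toCotangent γ q)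
        (mfderiv 𝓘(ℝ, E) (cotangentModel E) (toCotangent γ) q (vel (toCotangent γ q))) ↔
      mvfderiv 𝓘(ℝ, E) (Hm ∘ toCotangent γ) q ∈ annihilator Δ q := by
  have hQ : IsManifold 𝓘(ℝ, E) 1 Q := .of_le (n := ∞) (by norm_num)
  set A := fderiv ℝ (formInChart 𝓘(ℝ, E) γ q) (extChartAt 𝓘(ℝ, E) q q)
  have hmf (u : E) : (mfderiv 𝓘(ℝ, E) (cotangentModel E) (toCotangent γ) q u :
      E × (E →L[ℝ] ℝ)) = (u, A u) := by
    rw [(hγ.hasMFDerivAt q).mfderiv]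
    rfl
  have hcomp (u : E) : mvfderiv 𝓘(ℝ, E) (Hm ∘ toCotangent γ) q u =
      mvfderiv (cotangentModel E) Hm (toCotangent γ q) (u, A u) := by
    have h := ((hH (toCotangent γ q)).hasMFDerivAt.comp q
      (hγ.hasMFDerivAt q).mdifferentiableAt.hasMFDerivAt).mfderiv
    refine (congrArg (fun B : E →L[ℝ] ℝ => B u) h).trans ?_
    exact congrArg (mvfderiv (cotangentModel E) Hm (toCotangent γ q)) (hmf u)
  refine (Iff.of_eq (congrArg (IsNonholonomicHamiltonVector Hm Δ (toCotangent γ q))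
    (hmf _))).trans ?_
  refine (isNonholonomicHamiltonVector_iff hv Δ _ _ _).trans ?_
  refine (and_iff_right rfl).trans ?_
  refine (and_iff_right hvΔ).trans (forall₂_congr fun u hu => ?_)
  have hd := (exteriorDeriv_apply 𝓘(ℝ, E) γ q (vel (toCotangent γ q)) u).symm.trans
    (hdγ _ hvΔ u hu)
  have h1 := (hcomp u).trans (mvfderiv_cotangent_apply hv (toCotangent γ q) u (A u))
  refine Iff.of_eq (congrArg (· = 0) (Eq.trans ?_ h1.symm))
  rw [add_comm]
  exact congrArg _ (sub_eq_zero.1 hd)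

end

/-! ### Tangency to the momentum space and uniqueness. -/

/-- Carrying the moving subspaces `Δ q` into the fixed subspace `Δ x` lets membership in `Δ` survive
differentiation along a curve. -/
theorem IsRegularDistribution.exists_straightening [FiniteDimensional ℝ E]
    {Δ : (q : Q) → Submodule ℝ (TangentSpace 𝓘(ℝ, E) q)} (hΔ : IsRegularDistribution Δ) (x : Q) :
    ∃ M : Q → E →L[ℝ] E, ContMDiffAt 𝓘(ℝ, E) 𝓘(ℝ, E →L[ℝ] E) ∞ M x ∧
      M x = ContinuousLinearMap.id ℝ E ∧
      ∀ᶠ q in 𝓝 x, ∀ v ∈ Δ q, M q (tangentCoord x q v) ∈ Δ x := by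
  have : CompleteSpace E := FiniteDimensional.complete ℝ E
  obtain ⟨U, k, X, hU, hxU, hX, hspan⟩ := hΔ x
  let Y : Fin k → Q → E := fun i q => tangentCoord x q (X i q)
  have hY (i : Fin k) : ContMDiffAt 𝓘(ℝ, E) 𝓘(ℝ, E) ∞ (Y i) x :=
    (contMDiffAt_vectorField_iff (X i) x ⊤).1 ((hX i).contMDiffAt (hU.mem_nhds hxU))
  have hYx (i : Fin k) : Y i x = X i x := tangentCoord_self x _
  have hlin : LinearIndependent ℝ (fun i => Y i x) := by
    have := (hspan x hxU).1
    exact (funext hYx : (fun i => Y i x) = fun i => X i x) ▸ this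
  -- A left inverse of the frame map at `x` supplies functionals `α i` dual to the frame.
  obtain ⟨f, hf⟩ := LinearMap.exists_leftInverse_of_injective _
    (LinearMap.ker_eq_bot.2 hlin.fintypeLinearCombination_injective)
  let α : Fin k → E →L[ℝ] ℝ := fun i =>
    ((LinearMap.proj (R := ℝ) (φ := fun _ : Fin k => ℝ) i).comp f).toContinuousLinearMap
  have hα (i j : Fin k) : α i (Y j x) = if i = j then 1 else 0 := by
    have := LinearMap.congr_fun hf (Pi.single j 1)
    have h2 := congrFun this i
    simpa [Pi.single_apply, Fintype.linearCombination_apply] using! h2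
  -- A perturbation of the identity sending the frame at `x` to the frame at `q`; its inverse is the
  -- required straightening.
  let A : Q → E →L[ℝ] E := fun q =>
    ContinuousLinearMap.id ℝ E + ∑ i, (α i).smulRight (Y i q - Y i x)
  have hAY (q : Q) (j : Fin k) : A q (Y j x) = Y j q := by
    simp [A, hα]
  have hAx : A x = ContinuousLinearMap.id ℝ E := by simp [A]
  have hA : ContMDiffAt 𝓘(ℝ, E) 𝓘(ℝ, E →L[ℝ] E) ∞ A x := by
    refine contMDiffAt_const.add (contMDiffAt_finsetSum fun i _ => ?_)
    exact (((ContinuousLinearMap.smulRightL ℝ E E (α i)).contDiff).contMDiff _).comp x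
      ((hY i).sub contMDiffAt_const)
  have hinv : (A x).IsInvertible := by
    rw [hAx]; exact ⟨ContinuousLinearEquiv.refl ℝ E, rfl⟩
  refine ⟨fun q => (A q).inverse, ?_, ?_, ?_⟩
  · exact (hinv.contDiffAt_map_inverse (n := ∞)).contMDiffAt.comp x hA
  · simp [hAx]
  · have hev : ∀ᶠ q in 𝓝 x, (A q).IsInvertible := by
      have h := ContinuousLinearEquiv.nhds (ContinuousLinearEquiv.refl ℝ E)
      rw [ContinuousLinearEquiv.coe_refl, ← hAx] at h
      exact hA.continuousAt.preimage_mem_nhds h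
    filter_upwards [hev, hU.mem_nhds hxU] with q hq hqU v hv
    rw [← (hspan q hqU).2] at hv
    rw [← (hspan x hxU).2]
    have hle : Submodule.span ℝ (Set.range fun i => X i q) ≤
        (Submodule.span ℝ (Set.range fun i => X i x)).comap
          ((A q).inverse.comp (tangentCoord x q)).toLinearMap := by
      rw [Submodule.span_le]
      rintro _ ⟨i, rfl⟩
      change (A q).inverse (Y i q) ∈ Submodule.span ℝ (Set.range fun i => X i x)
      rw [← hAY q i, hq.inverse_apply_self, hYx]
      exact Submodule.subset_span ⟨i, rfl⟩
    exact hle hv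

/-- Otherwise a functional vanishing on `S` but not at `f'` would be constant along `f` with nonzero
derivative. -/
theorem hasDerivAt_mem_of_eventually_mem [FiniteDimensional ℝ E] (S : Submodule ℝ E) {f : ℝ → E}
    {f' : E} {t : ℝ} (hf : HasDerivAt f f' t) (h : ∀ᶠ s in 𝓝 t, f s ∈ S) : f' ∈ S := by
  by_contra hn
  obtain ⟨ℓ, hℓ, hS⟩ := Submodule.exists_le_ker_of_notMem hn
  have h1 := (ℓ.toContinuousLinearMap.hasFDerivAt (x := f t)).comp_hasDerivAt t hf
  have h2 : ℓ.toContinuousLinearMap ∘ f =ᶠ[𝓝 t] fun _ => (0 : ℝ) := by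
    filter_upwards [h] with s hs
    exact hS hs
  exact hℓ (((hasDerivAt_const t (0 : ℝ)).congr_of_eventuallyEq h2).unique h1).symm

section

variable {g : (q : Q) → TangentSpace 𝓘(ℝ, E) q →L[ℝ] TangentSpace 𝓘(ℝ, E) q →L[ℝ] ℝ}

theorem IsSmoothMetric.mem_momentumSpace_iff (hg : IsSmoothMetric g)
    (hb : ∀ q, Function.Bijective (g q)) (V : Q → ℝ)
    (Δ : (q : Q) → Submodule ℝ (TangentSpace 𝓘(ℝ, E) q)) (z : CotangentBundle E Q) :
    z ∈ momentumSpace (mechanicalLagrangian g V) Δ ↔ velocity g z ∈ Δ z.proj := by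
  constructor
  · rintro ⟨⟨q, v⟩, hv, rfl⟩
    have : velocity g (legendre (mechanicalLagrangian g V) ⟨q, v⟩) = v :=
      (velocity_eq_iff hb _ _).2
        (congrFun (hg.fiberLegendre_mechanicalLagrangian V q) v)
    exact (Iff.of_eq (congrArg (· ∈ Δ q) this)).2 hv
  · intro h
    refine ⟨⟨z.proj, velocity g z⟩, h, ?_⟩
    obtain ⟨q, p⟩ := z
    have := congrFun (hg.fiberLegendre_mechanicalLagrangian V q) (velocity g ⟨q, p⟩)
    have h2 := this.trans (metric_velocity hb ⟨q, p⟩)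
    exact congrArg (TotalSpace.mk q) h2

/-- If `g` is non-degenerate on `Δ`, there is at most one vector at `z ∈ P` that is tangent
to `P` and satisfies the nonholonomic Hamilton equations. -/
theorem IsNonholonomicHamiltonVector.unique [FiniteDimensional ℝ E] (hg : IsSmoothMetric g)
    (hb : ∀ q, Function.Bijective (g q)) {V : Q → ℝ} (hV : ContMDiff 𝓘(ℝ, E) 𝓘(ℝ, ℝ) ∞ V)
    {Δ : (q : Q) → Submodule ℝ (TangentSpace 𝓘(ℝ, E) q)} (hΔ : IsRegularDistribution Δ)
    {z : CotangentBundle E Q} (hnd : ∀ v ∈ Δ z.proj, (∀ w ∈ Δ z.proj, g z.proj v w = 0) → v = 0)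
    {w₁ w₂ : TangentSpace (cotangentModel E) z}
    (h₁ : IsNonholonomicHamiltonVector (hamiltonian (mechanicalLagrangian g V)) Δ z w₁)
    (h₂ : IsNonholonomicHamiltonVector (hamiltonian (mechanicalLagrangian g V)) Δ z w₂)
    {ζ₁ ζ₂ : ℝ → CotangentBundle E Q} {t₁ t₂ : ℝ} (hz₁ : ζ₁ t₁ = z) (hz₂ : ζ₂ t₂ = z)
    (hP₁ : ∀ᶠ t in 𝓝 t₁, ζ₁ t ∈ momentumSpace (mechanicalLagrangian g V) Δ)
    (hP₂ : ∀ᶠ t in 𝓝 t₂, ζ₂ t ∈ momentumSpace (mechanicalLagrangian g V) Δ)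
    (hd₁ : HasMFDerivAt 𝓘(ℝ, ℝ) (cotangentModel E) ζ₁ t₁
      ((1 : ℝ →L[ℝ] ℝ).smulRight (show E × (E →L[ℝ] ℝ) from w₁)))
    (hd₂ : HasMFDerivAt 𝓘(ℝ, ℝ) (cotangentModel E) ζ₂ t₂
      ((1 : ℝ →L[ℝ] ℝ).smulRight (show E × (E →L[ℝ] ℝ) from w₂))) :
    w₁ = w₂ := by
  obtain ⟨M, hM, hMx, hMΔ⟩ := hΔ.exists_straightening z.proj
  -- Near `z`, `F` maps `P` into the fixed subspace `Δ z.proj`, so its differential sends velocities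
  -- of curves in `P` there.
  let F : CotangentBundle E Q → E := fun y => M y.proj (tangentCoord z.proj y.proj (velocity g y))
  have hproj : ContMDiffAt (cotangentModel E) 𝓘(ℝ, E) ∞
      (fun y : CotangentBundle E Q => y.proj) z := contMDiff_proj _ z
  have hF : MDifferentiableAt (cotangentModel E) 𝓘(ℝ, E) F z :=
    ContMDiffAt.mdifferentiableAt (n := ∞)
      ((hM.comp z hproj).clm_apply (hg.contMDiffAt_velocity hb z)) (by simp)
  have hmem {w : E × (E →L[ℝ] ℝ)} {ζ : ℝ → CotangentBundle E Q} {t₀ : ℝ}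
      (hz : ζ t₀ = z)
      (hP : ∀ᶠ t in 𝓝 t₀, ζ t ∈ momentumSpace (mechanicalLagrangian g V) Δ)
      (hd : HasMFDerivAt 𝓘(ℝ, ℝ) (cotangentModel E) ζ t₀ ((1 : ℝ →L[ℝ] ℝ).smulRight w)) :
      mvfderiv (cotangentModel E) F z w ∈ Δ z.proj := by
    have hF' : MDifferentiableAt (cotangentModel E) 𝓘(ℝ, E) F (ζ t₀) := hz.symm ▸ hF
    have h : HasDerivAt (F ∘ ζ) (mvfderiv (cotangentModel E) F (ζ t₀) w) t₀ := by
      have h' : HasFDerivAt (F ∘ ζ) ((show E × (E →L[ℝ] ℝ) →L[ℝ] E from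
          mvfderiv (cotangentModel E) F (ζ t₀)).comp ((1 : ℝ →L[ℝ] ℝ).smulRight w)) t₀ :=
        (hF'.hasMFDerivAt.comp t₀ hd).hasFDerivAt
      refine h'.hasDerivAt.congr_deriv ?_
      exact congrArg (mvfderiv (cotangentModel E) F (ζ t₀)) (one_smul ℝ w)
    have h2 : (mvfderiv (cotangentModel E) F (ζ t₀) w : E) = mvfderiv (cotangentModel E) F z w :=
      congrArg (fun y => (mvfderiv (cotangentModel E) F y : E × (E →L[ℝ] ℝ) → E) w) hz
    rw [← h2]
    refine hasDerivAt_mem_of_eventually_mem (E := E) (Δ z.proj) h ?_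
    have hc : Filter.Tendsto (fun t => (ζ t).proj) (𝓝 t₀) (𝓝 z.proj) := by
      have := (hproj.continuousAt.tendsto.comp (hz ▸ hd.continuousAt.tendsto :
        Filter.Tendsto ζ (𝓝 t₀) (𝓝 z)))
      exact this
    filter_upwards [hP, hc.eventually hMΔ] with t ht htΔ
    exact htΔ _ ((hg.mem_momentumSpace_iff hb V Δ _).1 ht)
  obtain ⟨q, p⟩ := z
  obtain ⟨a₁, α₁⟩ := w₁
  obtain ⟨a₂, α₂⟩ := w₂
  have hv := hg.mvfderiv_hamiltonian_vertical hb hV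
  obtain ⟨ha₁, -, hα₁⟩ := (isNonholonomicHamiltonVector_iff hv Δ _ a₁ α₁).1 h₁
  obtain ⟨ha₂, -, hα₂⟩ := (isNonholonomicHamiltonVector_iff hv Δ _ a₂ α₂).1 h₂
  have ha : a₁ = a₂ := ha₁.trans ha₂.symm
  subst ha
  -- At the base point the straightening is the identity, so `F` restricted to the fibre is the
  -- linear map `g⁻¹`.
  have hD : HasFDerivAt (fun p' : E →L[ℝ] ℝ => F (fiberInclusion q p'))
      ((metricEquiv hb q).symm : (E →L[ℝ] ℝ) →L[ℝ] E) p := by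
    have : (fun p' : E →L[ℝ] ℝ => F (fiberInclusion q p')) = (metricEquiv hb q).symm := by
      funext p'
      have h1 : F (fiberInclusion q p') = velocity g (fiberInclusion q p') := by
        exact (congrArg (fun A : E →L[ℝ] E => A (tangentCoord q q
          (velocity g (fiberInclusion q p')))) hMx).trans (tangentCoord_self q _)
      exact h1.trans (velocity_fiberInclusion hb q p')
    rw [this]
    exact (metricEquiv hb q).symm.hasFDerivAt
  have hmem' : (metricEquiv hb q).symm (α₁ - α₂) ∈ Δ q := by
    have h := (Δ q).sub_mem (hmem hz₁ hP₁ hd₁) (hmem hz₂ hP₂ hd₂)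
    have h1 := mvfderiv_vertical (q := q) hF hD (α₁ - α₂)
    have h2 : (a₁, α₁) - (a₁, α₂) = ((0 : E), α₁ - α₂) := by simp
    have h3 := ((mvfderiv (cotangentModel E) F ⟨q, p⟩).map_sub (a₁, α₁) (a₁, α₂)).symm.trans
      ((congrArg (mvfderiv (cotangentModel E) F ⟨q, p⟩) h2).trans h1)
    exact h3 ▸ h
  -- Subtracting the two momentum equations shows that `α₁ - α₂` kills `Δ`, so `g⁻¹(α₁ - α₂)`,
  -- already in `Δ`, is `g`-orthogonal to `Δ`.
  have h0 : (metricEquiv hb q).symm (α₁ - α₂) = 0 := by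
    refine hnd _ hmem' fun u hu => ?_
    have h1 : g q ((metricEquiv hb q).symm (α₁ - α₂)) = α₁ - α₂ :=
      (metricEquiv hb q).apply_symm_apply _
    refine (congrArg (fun A : E →L[ℝ] ℝ => A u) h1).trans ?_
    have h2 := hα₁ u hu
    have h3 := hα₂ u hu
    change α₁ u - α₂ u = 0
    linarith
  have h4 : α₁ = α₂ := by
    rw [← sub_eq_zero]
    exact (map_eq_zero_iff _ (metricEquiv hb q).symm.injective).1 h0
  rw [h4]

end

/-! ### Lie brackets and functions with differential vanishing on the distribution. -/

section VectorSpace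

variable {F : Type*} [NormedAddCommGroup F] [NormedSpace ℝ F]

/-- Differentiating `df(V) = 0` and `df(W) = 0` expresses `df([V, W])` as a difference of second
derivatives of `f` in swapped order. -/
theorem fderiv_apply_lieBracket_eq_zero {f : F → ℝ} {V W : F → F} {x : F}
    (hf : ContDiffAt ℝ 2 f x) (hV : DifferentiableAt ℝ V x) (hW : DifferentiableAt ℝ W x)
    (hfV : ∀ᶠ y in 𝓝 x, fderiv ℝ f y (V y) = 0) (hfW : ∀ᶠ y in 𝓝 x, fderiv ℝ f y (W y) = 0) :
    fderiv ℝ f x (VectorField.lieBracket ℝ V W x) = 0 := by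
  have hd : DifferentiableAt ℝ (fderiv ℝ f) x :=
    (hf.fderiv_right (m := 1) (by norm_num)).differentiableAt (by simp)
  have key {Y : F → F} (hY : DifferentiableAt ℝ Y x)
      (hfY : ∀ᶠ y in 𝓝 x, fderiv ℝ f y (Y y) = 0) (u : F) :
      fderiv ℝ f x (fderiv ℝ Y x u) = -fderiv ℝ (fderiv ℝ f) x u (Y x) := by
    have h := (hd.hasFDerivAt.clm_apply hY.hasFDerivAt).unique
      ((hasFDerivAt_const (0 : ℝ) x).congr_of_eventuallyEq hfY)
    have := congrArg (fun A : F →L[ℝ] ℝ => A u) h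
    simp at this
    linarith
  rw [VectorField.lieBracket_eq, map_sub, key hW hfW, key hV hfV,
    hf.isSymmSndFDerivAt (by simp) (V x) (W x)]
  simp

end VectorSpace

theorem fderiv_comp_extChartAt_symm_apply {f : Q → ℝ} (hf : ContMDiff 𝓘(ℝ, E) 𝓘(ℝ, ℝ) ∞ f)
    (x : Q) {y : E} (hy : y ∈ (extChartAt 𝓘(ℝ, E) x).target) (v : E) :
    fderiv ℝ (f ∘ (extChartAt 𝓘(ℝ, E) x).symm) y v =
      mvfderiv 𝓘(ℝ, E) f ((extChartAt 𝓘(ℝ, E) x).symm y)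
        (mfderiv 𝓘(ℝ, E) 𝓘(ℝ, E) (extChartAt 𝓘(ℝ, E) x).symm y v) := by
  have hQ : IsManifold 𝓘(ℝ, E) 1 Q := .of_le (n := ∞) (by norm_num)
  have h := ((hf.mdifferentiable (by simp) ((extChartAt 𝓘(ℝ, E) x).symm y)).hasMFDerivAt.comp y
    (hasMFDerivAt_extChartAt_symm 𝓘(ℝ, E) x y hy)).mfderiv
  exact congrArg (fun A : E →L[ℝ] ℝ => A v) (mfderiv_eq_fderiv.symm.trans h)

theorem fderiv_comp_extChartAt_symm_self {f : Q → ℝ} (hf : ContMDiff 𝓘(ℝ, E) 𝓘(ℝ, ℝ) ∞ f)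
    (x : Q) (v : E) :
    fderiv ℝ (f ∘ (extChartAt 𝓘(ℝ, E) x).symm) (extChartAt 𝓘(ℝ, E) x x) v =
      mvfderiv 𝓘(ℝ, E) f x v := by
  have h : (mfderiv 𝓘(ℝ, E) 𝓘(ℝ, E) (extChartAt 𝓘(ℝ, E) x).symm (extChartAt 𝓘(ℝ, E) x x) v : E)
      = v := by
    rw [← tangent_symmL x x (mem_extChartAt_source x)]
    exact tangentCoordSymm_self x v
  refine (fderiv_comp_extChartAt_symm_apply hf x (mem_extChartAt_target x) v).trans ?_
  refine (congrArg (mvfderiv 𝓘(ℝ, E) f _) h).trans ?_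
  exact congrArg (fun y => (mvfderiv 𝓘(ℝ, E) f y : E → ℝ) v) (extChartAt_to_inv x)

theorem contDiffAt_comp_extChartAt_symm {f : Q → ℝ} (hf : ContMDiff 𝓘(ℝ, E) 𝓘(ℝ, ℝ) ∞ f) (x : Q)
    {y : E} (hy : y ∈ (extChartAt 𝓘(ℝ, E) x).target) :
    ContDiffAt ℝ ∞ (f ∘ (extChartAt 𝓘(ℝ, E) x).symm) y := by
  rw [← contMDiffAt_iff_contDiffAt]
  exact (hf _).comp y ((contMDiffOn_extChartAt_symm (n := ∞) x).contMDiffAt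
    ((isOpen_extChartAt_target x).mem_nhds hy))

theorem mvfderiv_mlieBracket_eq_zero [CompleteSpace E] {f : Q → ℝ}
    (hf : ContMDiff 𝓘(ℝ, E) 𝓘(ℝ, ℝ) ∞ f)
    {X Y : (q : Q) → TangentSpace 𝓘(ℝ, E) q} {U : Set Q} (hU : IsOpen U)
    (hX : IsSmoothVectorFieldOn X U) (hY : IsSmoothVectorFieldOn Y U)
    (hfX : ∀ q ∈ U, mvfderiv 𝓘(ℝ, E) f q (X q) = 0)
    (hfY : ∀ q ∈ U, mvfderiv 𝓘(ℝ, E) f q (Y q) = 0) {x : Q} (hx : x ∈ U) :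
    mvfderiv 𝓘(ℝ, E) f x (VectorField.mlieBracket 𝓘(ℝ, E) X Y x) = 0 := by
  have hQ : IsManifold 𝓘(ℝ, E) 1 Q := .of_le (n := ∞) (by norm_num)
  have hQ2 : IsManifold 𝓘(ℝ, E) 2 Q := .of_le (n := ∞) (by norm_cast)
  let rep (Z : (q : Q) → TangentSpace 𝓘(ℝ, E) q) : E → E :=
    VectorField.mpullbackWithin 𝓘(ℝ, E) 𝓘(ℝ, E) (extChartAt 𝓘(ℝ, E) x).symm Z (range 𝓘(ℝ, E))
  have hdiff {Z : (q : Q) → TangentSpace 𝓘(ℝ, E) q} (hZ : IsSmoothVectorFieldOn Z U) :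
      DifferentiableAt ℝ (rep Z) (extChartAt 𝓘(ℝ, E) x x) := by
    have h := ((hZ.contMDiffAt (hU.mem_nhds hx)).mdifferentiableAt (by simp)
      ).mdifferentiableWithinAt
      (s := univ)
    have h2 : DifferentiableWithinAt ℝ (rep Z)
        ((extChartAt 𝓘(ℝ, E) x).symm ⁻¹' univ ∩ range 𝓘(ℝ, E)) (extChartAt 𝓘(ℝ, E) x x) :=
      h.differentiableWithinAt_mpullbackWithin_vectorField
    exact h2.differentiableAt (by simp)
  have hrep {Z : (q : Q) → TangentSpace 𝓘(ℝ, E) q}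
      (hfZ : ∀ q ∈ U, mvfderiv 𝓘(ℝ, E) f q (Z q) = 0) :
      ∀ᶠ y in 𝓝 (extChartAt 𝓘(ℝ, E) x x),
        fderiv ℝ (f ∘ (extChartAt 𝓘(ℝ, E) x).symm) y (rep Z y) = 0 := by
    filter_upwards [extChartAt_target_mem_nhds (I := 𝓘(ℝ, E)) x,
      (continuousAt_extChartAt_symm (I := 𝓘(ℝ, E)) x).preimage_mem_nhds
        (by rw [extChartAt_to_inv]; exact hU.mem_nhds hx)] with y hy hyU
    have hi := isInvertible_mfderivWithin_extChartAt_symm (I := 𝓘(ℝ, E)) hy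
    have h1 := hi.self_apply_inverse (Z ((extChartAt 𝓘(ℝ, E) x).symm y))
    rw [fderiv_comp_extChartAt_symm_apply hf x hy]
    have h2 : mfderiv 𝓘(ℝ, E) 𝓘(ℝ, E) (extChartAt 𝓘(ℝ, E) x).symm y (rep Z y) =
        Z ((extChartAt 𝓘(ℝ, E) x).symm y) := by
      rw [← mfderivWithin_univ, ← range_id]
      exact h1
    rw [h2]
    exact hfZ _ hyU
  -- The manifold bracket is the pullback of the chart bracket by the derivative of the chart, which
  -- is the identity at `x`.
  have hb : (VectorField.mlieBracket 𝓘(ℝ, E) X Y x : E) =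
      VectorField.lieBracket ℝ (rep X) (rep Y) (extChartAt 𝓘(ℝ, E) x x) := by
    have hi := isInvertible_mfderiv_extChartAt (I := 𝓘(ℝ, E)) (mem_extChartAt_source x)
    have h2 : (extChartAt 𝓘(ℝ, E) x).symm ⁻¹' univ ∩ range 𝓘(ℝ, E) = univ := by simp
    have h3 : VectorField.lieBracketWithin ℝ (rep X) (rep Y)
        ((extChartAt 𝓘(ℝ, E) x).symm ⁻¹' univ ∩ range 𝓘(ℝ, E)) (extChartAt 𝓘(ℝ, E) x x) =
        VectorField.lieBracket ℝ (rep X) (rep Y) (extChartAt 𝓘(ℝ, E) x x) := by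
      rw [h2, VectorField.lieBracketWithin_univ]
    refine Eq.trans ?_ h3
    refine hi.inverse_apply_eq.2 ?_
    exact (congrArg (fun A : E →L[ℝ] E => A (VectorField.lieBracketWithin ℝ (rep X) (rep Y)
      ((extChartAt 𝓘(ℝ, E) x).symm ⁻¹' univ ∩ range 𝓘(ℝ, E)) (extChartAt 𝓘(ℝ, E) x x)))
      mfderiv_extChartAt_self).symm
  refine (fderiv_comp_extChartAt_symm_self hf x _).symm.trans ?_
  rw [hb]
  exact fderiv_apply_lieBracket_eq_zero
    ((contDiffAt_comp_extChartAt_symm hf x (mem_extChartAt_target x)).of_le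
      (by norm_cast))
    (hdiff hX) (hdiff hY) (hrep hfX) (hrep hfY)

/-- Smoothness is carried through the induction because the bracket step differentiates both fields.
-/
theorem IsIteratedBracket.smooth_and_mvfderiv_eq_zero [CompleteSpace E] {f : Q → ℝ}
    (hf : ContMDiff 𝓘(ℝ, E) 𝓘(ℝ, ℝ) ∞ f) {Δ : (q : Q) → Submodule ℝ (TangentSpace 𝓘(ℝ, E) q)}
    (hfΔ : ∀ q, ∀ v ∈ Δ q, mvfderiv 𝓘(ℝ, E) f q v = 0) {U : Set Q} (hU : IsOpen U)
    {Y : (q : Q) → TangentSpace 𝓘(ℝ, E) q} (hY : IsIteratedBracket Δ U Y) :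
    IsSmoothVectorFieldOn Y U ∧ ∀ q ∈ U, mvfderiv 𝓘(ℝ, E) f q (Y q) = 0 := by
  induction hY with
  | base X hX hΔ => exact ⟨hX, fun q hq => hfΔ q _ (hΔ q hq)⟩
  | bracket X Y hX hΔ hY ih =>
    refine ⟨fun q hq => ?_, fun q hq => ?_⟩
    · have : IsManifold 𝓘(ℝ, E) (minSmoothness ℝ 3) Q := .of_le (n := ∞) (by simp; norm_cast)
      have : IsManifold 𝓘(ℝ, E) (minSmoothness ℝ 2) Q := .of_le (n := ∞) (by simp; norm_cast)
      have : IsManifold 𝓘(ℝ, E) ((⊤ : ℕ∞) + 1) Q := by simpa using! ‹IsManifold 𝓘(ℝ, E) ∞ Q›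
      exact ((hX.contMDiffAt (hU.mem_nhds hq)).mlieBracket_vectorField (m := ⊤) (n := ⊤)
        (ih.1.contMDiffAt (hU.mem_nhds hq)) (by simp)).contMDiffWithinAt
    · exact mvfderiv_mlieBracket_eq_zero hf hU hX ih.1 (fun q hq => hfΔ q _ (hΔ q hq)) ih.2 hq

/-- Constancy on a convex ball in each chart gives local constancy, and connectedness does the rest.
-/
theorem eq_of_mvfderiv_eq_zero [PreconnectedSpace Q] {f : Q → ℝ}
    (hf : ContMDiff 𝓘(ℝ, E) 𝓘(ℝ, ℝ) ∞ f) (h0 : ∀ q v, mvfderiv 𝓘(ℝ, E) f q v = 0) (x y : Q) :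
    f x = f y := by
  have hl : IsLocallyConstant f := by
    rw [IsLocallyConstant.iff_eventually_eq]
    intro x
    obtain ⟨r, hr, hball⟩ := Metric.mem_nhds_iff.1 (extChartAt_target_mem_nhds (I := 𝓘(ℝ, E)) x)
    filter_upwards [extChartAt_source_mem_nhds (I := 𝓘(ℝ, E)) x,
      (continuousAt_extChartAt (I := 𝓘(ℝ, E)) x).preimage_mem_nhds (Metric.ball_mem_nhds _ hr)]
      with q hq hqr
    have := (convex_ball (extChartAt 𝓘(ℝ, E) x x) r).is_const_of_fderivWithin_eq_zero (𝕜 := ℝ)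
      (f := f ∘ (extChartAt 𝓘(ℝ, E) x).symm)
      (fun y hy => ((contDiffAt_comp_extChartAt_symm hf x (hball hy)).differentiableAt
        (by simp)).differentiableWithinAt)
      (fun y hy => by
        rw [fderivWithin_of_isOpen Metric.isOpen_ball hy]
        refine ContinuousLinearMap.ext fun v => ?_
        rw [fderiv_comp_extChartAt_symm_apply hf x (hball hy)]
        exact h0 _ _) hqr (Metric.mem_ball_self hr)
    rwa [Function.comp_apply, Function.comp_apply, (extChartAt 𝓘(ℝ, E) x).left_inv hq,
      extChartAt_to_inv] at this
  exact hl.apply_eq_of_isPreconnected isPreconnected_univ (mem_univ x) (mem_univ y)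

theorem IsCompletelyNonholonomic.eq_of_mvfderiv_eq_zero [CompleteSpace E] [PreconnectedSpace Q]
    {Δ : (q : Q) → Submodule ℝ (TangentSpace 𝓘(ℝ, E) q)} (hΔ : IsCompletelyNonholonomic Δ)
    {f : Q → ℝ} (hf : ContMDiff 𝓘(ℝ, E) 𝓘(ℝ, ℝ) ∞ f)
    (hfΔ : ∀ q, ∀ v ∈ Δ q, mvfderiv 𝓘(ℝ, E) f q v = 0) (x y : Q) : f x = f y := by
  refine NonholonomicHJ.eq_of_mvfderiv_eq_zero hf (fun q v => ?_) x y
  have hle : Submodule.span ℝ {v : TangentSpace 𝓘(ℝ, E) q | ∃ (U : Set Q)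
      (Y : (q : Q) → TangentSpace 𝓘(ℝ, E) q), IsOpen U ∧ q ∈ U ∧ IsIteratedBracket Δ U Y ∧
      Y q = v} ≤ LinearMap.ker (mvfderiv 𝓘(ℝ, E) f q).toLinearMap := by
    rw [Submodule.span_le]
    rintro _ ⟨U, Y, hU, hq, hY, rfl⟩
    exact (hY.smooth_and_mvfderiv_eq_zero hf hfΔ hU).2 q hq
  rw [hΔ q] at hle
  exact hle (Submodule.mem_top (x := v))

/-! ### Integral curves and their lifts. -/

theorem exists_isMIntegralCurveOn_Ioo [CompleteSpace E] [T2Space Q]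
    {X : (q : Q) → TangentSpace 𝓘(ℝ, E) q} (hX : IsSmoothVectorFieldOn X univ) (q : Q) :
    ∃ (c : ℝ → Q) (ε : ℝ), 0 < ε ∧ c 0 = q ∧ IsMIntegralCurveOn c X (Ioo (-ε) ε) := by
  have hQ : IsManifold 𝓘(ℝ, E) 1 Q := .of_le (n := ∞) (by norm_num)
  obtain ⟨c, hc0, hc⟩ := exists_isMIntegralCurveAt_of_contMDiffAt_boundaryless 0
    ((contMDiffOn_univ.1 hX q).of_le (m := 1) (by simp))
  obtain ⟨ε, hε, h⟩ := isMIntegralCurveAt_iff'.1 hc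
  rw [Real.ball_eq_Ioo, zero_sub, zero_add] at h
  exact ⟨c, ε, hε, hc0, h⟩

theorem IsSmoothOneForm.hasMFDerivAt_comp_curve {γ : (q : Q) → TangentSpace 𝓘(ℝ, E) q →L[ℝ] ℝ}
    (hγ : IsSmoothOneForm γ) {X : (q : Q) → TangentSpace 𝓘(ℝ, E) q} {c : ℝ → Q} {J : Set ℝ}
    (hJ : IsOpen J) (hc : IsMIntegralCurveOn c X J) {t : ℝ} (ht : t ∈ J) :
    HasMFDerivAt 𝓘(ℝ, ℝ) (cotangentModel E) (fun s => toCotangent γ (c s)) t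
      ((1 : ℝ →L[ℝ] ℝ).smulRight
        (mfderiv 𝓘(ℝ, E) (cotangentModel E) (toCotangent γ) (c t) (X (c t)))) := by
  have h := (hγ.mdifferentiable (by simp) (c t)).hasMFDerivAt.comp t
    ((hc t ht).hasMFDerivAt (hJ.mem_nhds ht))
  refine h.congr_mfderiv ?_
  refine ContinuousLinearMap.ext fun s => ?_
  exact (mfderiv 𝓘(ℝ, E) (cotangentModel E) (toCotangent γ) (c t)).map_smul s (X (c t))

theorem velocity_unique {ζ : ℝ → CotangentBundle E Q} {t : ℝ} {w w' : E × (E →L[ℝ] ℝ)}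
    (h : HasMFDerivAt 𝓘(ℝ, ℝ) (cotangentModel E) ζ t ((1 : ℝ →L[ℝ] ℝ).smulRight w))
    (h' : HasMFDerivAt 𝓘(ℝ, ℝ) (cotangentModel E) ζ t ((1 : ℝ →L[ℝ] ℝ).smulRight w')) :
    w = w' := by
  have := congrArg (fun A : ℝ →L[ℝ] E × (E →L[ℝ] ℝ) => A 1) (hasMFDerivAt_unique h h')
  exact (one_smul ℝ w).symm.trans (this.trans (one_smul ℝ w'))

section

variable {g : (q : Q) → TangentSpace 𝓘(ℝ, E) q →L[ℝ] TangentSpace 𝓘(ℝ, E) q →L[ℝ] ℝ}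

theorem IsSmoothMetric.isSmoothVectorFieldOn_velocity [FiniteDimensional ℝ E]
    (hg : IsSmoothMetric g) (hb : ∀ q, Function.Bijective (g q))
    {γ : (q : Q) → TangentSpace 𝓘(ℝ, E) q →L[ℝ] ℝ} (hγ : IsSmoothOneForm γ) :
    IsSmoothVectorFieldOn (fun q => velocity g (toCotangent γ q)) univ := by
  refine contMDiffOn_univ.2 fun q => ?_
  exact (contMDiffAt_vectorField_iff _ q ⊤).2
    ((hg.contMDiffAt_velocity hb (toCotangent γ q)).comp q (hγ q))

end

end NonholonomicHJ

end

/-! ### The main theorem. -/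

open NonholonomicHJ in
theorem mainTheorem4
    {E : Type*} [NormedAddCommGroup E] [NormedSpace ℝ E] [FiniteDimensional ℝ E]
    {Q : Type*} [TopologicalSpace Q] [T2Space Q] [SecondCountableTopology Q]
    [ChartedSpace E Q] [IsManifold 𝓘(ℝ, E) ∞ Q]
    (g : (q : Q) → TangentSpace 𝓘(ℝ, E) q →L[ℝ] TangentSpace 𝓘(ℝ, E) q →L[ℝ] ℝ)
    (hg : IsSmoothMetric g)
    (V : Q → ℝ) (hV : ContMDiff 𝓘(ℝ, E) 𝓘(ℝ, ℝ) ∞ V)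
    (hL : IsNonDegenerate (mechanicalLagrangian g V))
    (Δ : (q : Q) → Submodule ℝ (TangentSpace 𝓘(ℝ, E) q)) (hΔ : IsRegularDistribution Δ)
    (γ : (q : Q) → TangentSpace 𝓘(ℝ, E) q →L[ℝ] ℝ) (hγ : IsSmoothOneForm γ)
    (hγP : ∀ q, toCotangent γ q ∈ momentumSpace (mechanicalLagrangian g V) Δ)
    (hdγ : ∀ q, ∀ v ∈ Δ q, ∀ w ∈ Δ q, exteriorDeriv 𝓘(ℝ, E) γ q v w = 0) :
    -- equivalence, integral curves of `X_H^nh` being read as solutions of its defining equations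
    ((∀ (c : ℝ → Q) (J : Set ℝ), IsOpen J → J.OrdConnected →
        IsMIntegralCurveOn c
          (projectedHamiltonianVectorField (hamiltonian (mechanicalLagrangian g V)) γ) J →
        SolvesNonholonomicHamilton (hamiltonian (mechanicalLagrangian g V)) Δ
          (fun t => toCotangent γ (c t)) J) ↔
      NonholonomicHamiltonJacobi (hamiltonian (mechanicalLagrangian g V)) Δ γ) ∧
    -- the same for the vector field `X_H^nh` along `P`, which is unique when `g` is
    -- non-degenerate on `Δ`
    ((∀ q, ∀ v ∈ Δ q, (∀ w ∈ Δ q, g q v w = 0) → v = 0) →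
      ∀ X : (z : CotangentBundle E Q) → TangentSpace (cotangentModel E) z,
        IsNonholonomicHamiltonVectorField (hamiltonian (mechanicalLagrangian g V)) Δ
          (momentumSpace (mechanicalLagrangian g V) Δ) X →
        ((∀ (c : ℝ → Q) (J : Set ℝ), IsOpen J → J.OrdConnected →
            IsMIntegralCurveOn c
              (projectedHamiltonianVectorField (hamiltonian (mechanicalLagrangian g V)) γ) J →
            IsMIntegralCurveOn (fun t => toCotangent γ (c t)) X J) ↔
          NonholonomicHamiltonJacobi (hamiltonian (mechanicalLagrangian g V)) Δ γ)) ∧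
    (ConnectedSpace Q → IsCompletelyNonholonomic Δ →
      (NonholonomicHamiltonJacobi (hamiltonian (mechanicalLagrangian g V)) Δ γ ↔
        ∃ e : ℝ, ∀ q, hamiltonian (mechanicalLagrangian g V) (toCotangent γ q) = e)) := by
  have : CompleteSpace E := FiniteDimensional.complete ℝ E
  have hb (q : Q) : Function.Bijective (g q) := by
    have := hL.bijective q
    rwa [hg.fiberLegendre_mechanicalLagrangian] at this
  set Hm := hamiltonian (mechanicalLagrangian g V) with hHm
  have hv : ∀ z (β : E →L[ℝ] ℝ), mvfderiv (cotangentModel E) Hm z ((0 : E), β) =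
      β (velocity g z) := hg.mvfderiv_hamiltonian_vertical hb hV
  have hHs : ContMDiff (cotangentModel E) 𝓘(ℝ, ℝ) ∞ Hm := hg.contMDiff_hamiltonian hb hV
  have hfs : ContMDiff 𝓘(ℝ, E) 𝓘(ℝ, ℝ) ∞ (Hm ∘ toCotangent γ) := hHs.comp hγ
  have hproj : projectedHamiltonianVectorField Hm γ = fun q => velocity g (toCotangent γ q) :=
    funext fun q => tangentProj_hamiltonianVectorField hv (toCotangent γ q)
  rw [hproj]
  have hvΔ (q : Q) : velocity g (toCotangent γ q) ∈ Δ q :=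
    (hg.mem_momentumSpace_iff hb V Δ _).1 (hγP q)
  -- Pointwise equivalence; both curve statements reduce to it.
  have hkey (q : Q) := isNonholonomicHamiltonVector_toCotangent_iff
    (hHs.mdifferentiable (by simp)) hv hγ (hvΔ q) (hdγ q)
  have hex := exists_isMIntegralCurveOn_Ioo (hg.isSmoothVectorFieldOn_velocity hb hγ)
  refine ⟨⟨fun h q => ?_, fun h c J hJ _ hc t ht => ?_⟩, fun hnd X hX =>
    ⟨fun h q => ?_, fun h c J hJ _ hc t ht => ?_⟩, fun hconn hΔc => ⟨fun h => ?_, ?_⟩⟩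
  · obtain ⟨c, ε, hε, rfl, hc⟩ := hex q
    have h0 : (0 : ℝ) ∈ Ioo (-ε) ε := ⟨neg_lt_zero.2 hε, hε⟩
    obtain ⟨w, hw, hNH⟩ := h c _ isOpen_Ioo ordConnected_Ioo hc 0 h0
    have := velocity_unique hw (hγ.hasMFDerivAt_comp_curve isOpen_Ioo hc h0)
    exact (hkey (c 0)).1 (this ▸ hNH)
  · exact ⟨_, hγ.hasMFDerivAt_comp_curve hJ hc ht, (hkey (c t)).2 (h (c t))⟩
  · obtain ⟨c, ε, hε, rfl, hc⟩ := hex q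
    have h0 : (0 : ℝ) ∈ Ioo (-ε) ε := ⟨neg_lt_zero.2 hε, hε⟩
    have hw := (h c _ isOpen_Ioo ordConnected_Ioo hc 0 h0).hasMFDerivAt (isOpen_Ioo.mem_nhds h0)
    have := velocity_unique hw (hγ.hasMFDerivAt_comp_curve isOpen_Ioo hc h0)
    exact (hkey (c 0)).1 (this ▸ (hX _ (hγP (c 0))).2)
  · have hlift := hγ.hasMFDerivAt_comp_curve hJ hc ht
    obtain ⟨⟨ζ, hζ0, hζP, hζd⟩, hNH⟩ := hX _ (hγP (c t))
    -- The lift lies in `P` because `γ` does, so its velocity at time `t` and `X`, realized by a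
    -- curve `ζ` at time `0`, are both tangent to `P` and solve the equations.
    have heq := IsNonholonomicHamiltonVector.unique hg hb hV hΔ (hnd (c t))
      ((hkey (c t)).2 (h (c t))) hNH (ζ₁ := fun s => toCotangent γ (c s)) (t₁ := t) rfl hζ0
      (Filter.Eventually.of_forall fun s => hγP (c s)) hζP hlift (hζ0 ▸ hζd)
    have hgoal : HasMFDerivAt 𝓘(ℝ, ℝ) (cotangentModel E) (fun s => toCotangent γ (c s)) t
        ((1 : ℝ →L[ℝ] ℝ).smulRight (X (toCotangent γ (c t)))) := heq ▸ hlift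
    exact hgoal.hasMFDerivWithinAt
  · obtain ⟨q₀⟩ := hconn.toNonempty
    exact ⟨_, fun q => hΔc.eq_of_mvfderiv_eq_zero hfs h q q₀⟩
  · rintro ⟨e, he⟩ q v _
    have : Hm ∘ toCotangent γ = fun _ => e := funext he
    rw [this, mvfderiv_const]
    rfl
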